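/- Let $\mathbb K$ be a field of characteristic zero and $\mathcal C$ a set. Let $\mathcal H=\mathcal H_{MKW}$ be the Munthe-Kaas–Wright Hopf algebra over $\mathbb K$: its basis consists of the ordered forests (finite sequences of planar rooted trees with vertices decorated by $\mathcal C$), its product is the shuffle product of forests, its unit $1$ is the empty forest, its counit $\epsilon$ is the coefficient of the empty forest, and its coproduct is $\Delta(\omega)=\sum_c P^c(\omega)\otimes T^c(\omega)$, where $c$ runs over the left-admissible cuts of $\omega$. Here the roots of $\omega$ are regarded as the children of one additional invisible root; a set $c$ of edges (including those to the invisible root) is left-admissible if with each edge it contains all edges leaving the same vertex to its left, and if each path from the invisible root to a leaf contains at most one edge of $c$; $T^c(\omega)$ is the trunk that remains (with the invisible root removed), and $P^c(\omega)$ is the shuffle product, over the vertices, of the ordered forests cut off from each vertex. Let $\hat\Delta(x)=\Delta(x)-x\otimes1-1\otimes x=:x^{(1)}\otimes x^{(2)}$ and let $P(\mathcal H)=\ker\hat\Delta$ be the space of primitive elements. Define a bilinear map $\top:\mathcal H\times\mathcal H\to\mathcal H$ on forests by $$\omega_1\top\omega_2=\frac1{|\omega_2|}\sum_{v}\omega_1\top_v\omega_2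 ,$$ where $v$ runs over the $|\omega_2|$ vertices of $\omega_2$ and $\omega_1\top_v\omega_2$ is the sum of the forests obtained by grafting all roots of $\omega_1$ onto $v$, the new edges (in their order) being shuffled with the edges already leaving $v$; for the empty forest $\omega_2=1$ put $\omega_1\top 1=0$. Then: 1. $\top$ is a natural growth operator for $\mathcal H$: for every $x\in\mathcal H$ and every primitive $y\in P(\mathcal H)$, $$\hat\Delta(x\top y)=x\otimes y+x^{(1)}\otimes(x^{(2)}\top y).$$ 2. $\mathcal H$ is cofree: the linear map from the tensor coalgebra $\bigoplus_{n\ge0}P(\mathcal H)^{\otimes n}$ (with deconcatenation as coproduct and the projection onto degree $0$ as counit) to $\mathcal H$ that sends the empty word to $1$ and $p_1\otimes\cdots\otimes p_n$ to $p_1\top\cdots\top p_n:=(\cdots((p_1\top p_2)\top p_3)\cdots)\top p_n$ is an isomorphism of coalgebras. 3. There is exactly one linear map $\pi:\mathcal H\to\mathcal H$ such that $\pi(1)=0$ and $\pi(x)=x-x^{(1)}\top\pi(x^{(2)})$ for all $x$ with $\epsilon(x)=0$, and $\pi$ is a projection of $\mathcal H$ onto $P(\mathcal H)$ (that is, $\pi(\mathcal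 H)\subseteq P(\mathcal H)$ and $\pi(p)=p$ for all $p\in P(\mathcal H)$). -/

import Mathlib

open scoped TensorProduct

universe u v

/-! ### Planar rooted trees and ordered forests -/

/-- Planar rooted trees with vertices decorated by `C`: a root decoration together with the ordered
list (from left to right) of the subtrees attached to the root. -/
inductive PlanarTree (C : Type u) : Type u
  | node (a : C) (children : List (PlanarTree C)) : PlanarTree C

/-- Ordered forests: finite sequences of planar rooted trees. -/
abbrev OrderedForest (C : Type u) : Type u := List (PlanarTree C)

/-- All shuffles of two words, with multiplicity. -/
def shuffles {α : Type u} : List α → List α → List (List α)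
  | [], w => [w]
  | a :: u, [] => [a :: u]
  | a :: u, b :: w =>
      (shuffles u (b :: w)).map (a :: ·) ++ (shuffles (a :: u) w).map (b :: ·)
termination_by u w => u.length + w.length

namespace OrderedForest

variable {C : Type u}

/-- The number `|ω|` of vertices of an ordered forest. -/
def numVertices : OrderedForest C → ℕ
  | [] => 0
  | .node _ ch :: ω => 1 + numVertices ch + numVertices ω

/-- The list, with multiplicity, of all forests obtained by choosing a vertex `v` of the second
argument and grafting all roots of `ω₁` onto `v`, the new edges being shuffled with the edges
already leaving `v`.  In the recursive clause the vertex `v` is, respectively, the first root, a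
vertex strictly above the first root, or a vertex of one of the remaining trees. -/
def grafts (ω₁ : OrderedForest C) : OrderedForest C → List (OrderedForest C)
  | [] => []
  | .node a ch :: ω =>
      (shuffles ω₁ ch).map (fun ch' => .node a ch' :: ω) ++
      (grafts ω₁ ch).map (fun ch' => .node a ch' :: ω) ++
      (grafts ω₁ ω).map (fun ω' => .node a ch :: ω')

end OrderedForest

/-- The outcome of a left-admissible cut of an ordered forest, the roots of the forest being
regarded as the children of one additional invisible root, so that the forest's own roots can also
be cut off.
* `severed`: the trees of the forest that are cut off from the invisible root, in planar order;
* `bundles`: for each vertex of the forest that remains in the trunk, the forest that is cut off from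
  that vertex, in planar order (possibly empty);
* `trunk`: what remains. -/
structure LeftCut (C : Type u) where
  severed : OrderedForest C
  bundles : List (OrderedForest C)
  trunk : OrderedForest C

namespace OrderedForest

variable {C : Type u}

/-- The list of all left-admissible cuts of an ordered forest: with each cut edge, all edges leaving
the same vertex to its left are cut too, and no path going up from the root contains two cut edges.

For the forest `τ ω` with first tree `τ = node a ch`, either `τ` is cut off (then no edge
inside `τ` is cut, and the cut of `ω` is arbitrary), or `τ` is not cut off; in the latter case, by
left-admissibility, no tree of `ω` is cut off as a whole, and the edges in `τ` are cut according to
a left-admissible cut of the forest `ch` growing on its root. -/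
def leftCuts : OrderedForest C → List (LeftCut C)
  | [] => [⟨[], [], []⟩]
  | .node a ch :: ω =>
      (leftCuts ω).map (fun d => ⟨.node a ch :: d.severed, d.bundles, d.trunk⟩) ++
      (leftCuts ch).flatMap (fun c =>
        ((leftCuts ω).filter (fun d => d.severed.isEmpty)).map (fun d =>
          ⟨[], (c.severed :: c.bundles) ++ d.bundles, .node a c.trunk :: d.trunk⟩))

end OrderedForest

/-! ### Reduced coproduct, primitive elements, natural growth -/

section NaturalGrowth

variable (K : Type u) {H : Type v} [CommRing K] [AddCommGroup H] [Module K H]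
  [CoalgebraStruct K H] [One H]

/-- The reduced coproduct `x ↦ Δ(x) - x ⊗ 1 - 1 ⊗ x`. -/
noncomputable def reducedComul : H →ₗ[K] H ⊗[K] H :=
  CoalgebraStruct.comul - (TensorProduct.mk K H H).flip 1 - TensorProduct.mk K H H 1

variable (H) in
/-- The space of primitive elements: the kernel of the reduced coproduct. -/
noncomputable def primitiveElements : Submodule K H := LinearMap.ker (reducedComul K (H := H))

variable {K}

/-- The bilinear map `T` is a natural growth operator: for all `x` and all primitive `y`,
`Δ̂(x ⊤ y) = x ⊗ y + x⁽¹⁾ ⊗ (x⁽²⁾ ⊤ y)`, where `Δ̂(x) = x⁽¹⁾ ⊗ x⁽²⁾` is the reduced coproduct. -/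
def IsNaturalGrowth (T : H →ₗ[K] H →ₗ[K] H) : Prop :=
  ∀ x y : H, y ∈ primitiveElements K H →
    reducedComul K (T x y) = x ⊗ₜ[K] y + (T.flip y).lTensor H (reducedComul K x)

/-- The linear map `π` satisfies the recursion `π(x) = x - x⁽¹⁾ ⊤ π(x⁽²⁾)` on the augmentation
ideal (the kernel of the counit), and `π(1) = 0`. -/
def IsRecursiveProjection (T : H →ₗ[K] H →ₗ[K] H) (π : H →ₗ[K] H) : Prop :=
  π 1 = 0 ∧ ∀ x : H, CoalgebraStruct.counit (R := K) x = 0 →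
    π x = x - TensorProduct.lift T (π.lTensor H (reducedComul K x))

/-- Iterated natural growth, bracketed to the left:
`x₁ ⊤ ⋯ ⊤ xₙ = ((x₁ ⊤ x₂) ⊤ ⋯) ⊤ xₙ`; the empty expression is `1`. -/
def iteratedGrowth (T : H →ₗ[K] H →ₗ[K] H) : List H → H
  | [] => 1
  | x :: l => l.foldl (fun z y => T z y) x

end NaturalGrowth

/-! ### The tensor coalgebra -/

/-- The vector space underlying the tensor coalgebra `⨁ₙ V^{⊗ n}`; its coproduct is
deconcatenation. -/
def TensorCoalgebra (K : Type u) (V : Type v) [CommRing K] [AddCommGroup V] [Module K V] :=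
  TensorAlgebra K V

namespace TensorCoalgebra

variable (K : Type u) {V : Type v} [CommRing K] [AddCommGroup V] [Module K V]

noncomputable instance : AddCommGroup (TensorCoalgebra K V) :=
  inferInstanceAs (AddCommGroup (TensorAlgebra K V))

noncomputable instance : Module K (TensorCoalgebra K V) :=
  inferInstanceAs (Module K (TensorAlgebra K V))

/-- The word `v₁ ⊗ ⋯ ⊗ vₙ`. -/
noncomputable def word (l : List V) : TensorCoalgebra K V :=
  (l.map (TensorAlgebra.ι K)).prod

/-- The inclusion of the `n`-th tensor power. -/
noncomputable def ofPower (n : ℕ) : (⨂[K]^n V) →ₗ[K] TensorCoalgebra K V :=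
  TensorPower.toTensorAlgebra

/-- Deconcatenation on `V^{⊗ n}`: the sum over `i + j = n` of the canonical identifications of
`V^{⊗ n}` with `V^{⊗ i} ⊗ V^{⊗ j}`. -/
noncomputable def deconcPower (n : ℕ) :
    (⨂[K]^n V) →ₗ[K] TensorCoalgebra K V ⊗[K] TensorCoalgebra K V :=
  ∑ p : Finset.HasAntidiagonal.antidiagonal n,
    TensorProduct.map (ofPower K p.1.1) (ofPower K p.1.2) ∘ₗ
      (TensorPower.mulEquiv (R := K) (M := V) (n := p.1.1) (m := p.1.2)).symm.toLinearMap ∘ₗ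
        (TensorPower.cast K V (Finset.HasAntidiagonal.mem_antidiagonal.mp p.2).symm).toLinearMap

/-- Deconcatenation on the whole tensor space. -/
noncomputable def deconc :
    TensorCoalgebra K V →ₗ[K] TensorCoalgebra K V ⊗[K] TensorCoalgebra K V :=
  DirectSum.toModule K ℕ _ (deconcPower K) ∘ₗ
    (TensorAlgebra.equivDirectSum (R := K) (M := V)).toLinearMap

/-- The tensor coalgebra: deconcatenation, and the projection onto `V^{⊗ 0} = K` as counit. -/
noncomputable instance : CoalgebraStruct K (TensorCoalgebra K V) where
  comul := deconc K
  counit := (TensorAlgebra.algebraMapInv (R := K) (M := V)).toLinearMap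

theorem deconcPower_append {i j : ℕ} (a : Fin i → V) (b : Fin j → V) (n : ℕ) (h : i + j = n) :
   (TensorPower.mulEquiv (R := K) (M := V) (n := i) (m := j)).symm
     (TensorPower.cast K V h.symm (TensorPower.cast K V h (PiTensorProduct.tprod K (Fin.append a b)))) = 
     (PiTensorProduct.tprod K a) ⊗ₜ (PiTensorProduct.tprod K b) := by
  subst h
  rw [LinearEquiv.symm_apply_eq]
  simp only [TensorPower.cast_refl, LinearEquiv.refl_apply]
  rw [← TensorPower.tprod_mul_tprod]; rfl

/-- The coproduct of the tensor coalgebra is deconcatenation of words. -/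
theorem comul_word (l : List V) :
    CoalgebraStruct.comul (R := K) (word K l) =
      ∑ k ∈ Finset.range (l.length + 1), word K (l.take k) ⊗ₜ[K] word K (l.drop k) := by
  have h1 : (TensorAlgebra.equivDirectSum (R := K) (M := V)) ((l.map (TensorAlgebra.ι K)).prod)
      = DirectSum.of (fun n => ⨂[K]^n V) l.length (PiTensorProduct.tprod K l.get) := by
    rw [TensorAlgebra.equivDirectSum_apply, ← TensorAlgebra.toDirectSum_tensorPower_tprod]
    congr 1
    rw [TensorAlgebra.tprod_apply]
    congr 1
    conv_lhs => rw [← List.ofFn_get l, List.map_ofFn]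
    rfl
  have h2 : CoalgebraStruct.comul (R := K) (word K l) = deconcPower K l.length (PiTensorProduct.tprod K l.get) := by
    change DirectSum.toModule K ℕ _ (deconcPower K) (TensorAlgebra.equivDirectSum ((l.map (TensorAlgebra.ι K)).prod)) = _
    rw [h1]
    exact DirectSum.toModule_lof (R := K) ..
  rw [h2, deconcPower, LinearMap.sum_apply]
  have h3 : ∀ p : Finset.HasAntidiagonal.antidiagonal l.length,
     (TensorProduct.map (ofPower K p.1.1) (ofPower K p.1.2) ∘ₗ
      (TensorPower.mulEquiv (R := K) (M := V) (n := p.1.1) (m := p.1.2)).symm.toLinearMap ∘ₗ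
        (TensorPower.cast K V (Finset.HasAntidiagonal.mem_antidiagonal.mp p.2).symm).toLinearMap) (PiTensorProduct.tprod K l.get)
      = word K (l.take p.1.1) ⊗ₜ[K] word K (l.drop p.1.1) := by
    rintro ⟨⟨i, j⟩, h⟩
    have h' : i + j = l.length := Finset.HasAntidiagonal.mem_antidiagonal.mp h
    have hw : ∀ (m) (f : Fin m → V), ofPower K m (PiTensorProduct.tprod K f) = word K (List.ofFn f) := by
      intro m f
      change TensorPower.toTensorAlgebra _ = _
      rw [TensorPower.toTensorAlgebra_tprod, TensorAlgebra.tprod_apply, word, List.map_ofFn]; rfl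
    have ha : PiTensorProduct.tprod K l.get = TensorPower.cast K V h' (PiTensorProduct.tprod K (Fin.append (fun x : Fin i => l.get ⟨x, by omega⟩) (fun x : Fin j => l.get ⟨i + x, by omega⟩))) := by
      rw [TensorPower.cast_tprod]
      congr 1
      funext x
      obtain ⟨y, rfl⟩ := (finCongr h').surjective x
      simp
      induction y using Fin.addCases <;> simp [Fin.append_left, Fin.append_right]
    simp only [LinearMap.comp_apply, LinearEquiv.coe_coe]
    rw [ha, deconcPower_append, TensorProduct.map_tmul, hw, hw]
    congr 2
    · apply List.ext_getElem <;> simp; omega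
    · apply List.ext_getElem <;> simp; omega
  rw [Finset.sum_congr rfl (fun p _ => h3 p), Finset.univ_eq_attach, Finset.sum_attach (Finset.HasAntidiagonal.antidiagonal l.length) (fun p => word K (l.take p.1) ⊗ₜ[K] word K (l.drop p.1))]
  exact Finset.Nat.sum_antidiagonal_eq_sum_range_succ (fun i _ => word K (l.take i) ⊗ₜ[K] word K (l.drop i)) _
end TensorCoalgebra

/-! ### The Munthe-Kaas--Wright Hopf algebra -/

/-- The vector space spanned by the ordered forests decorated by `C`. -/
def MKW (K : Type u) (C : Type v) [CommRing K] := OrderedForest C →₀ K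

namespace MKW

variable (K : Type u) {C : Type v} [CommRing K]

noncomputable instance : AddCommGroup (MKW K C) :=
  inferInstanceAs (AddCommGroup (OrderedForest C →₀ K))

noncomputable instance : Module K (MKW K C) :=
  inferInstanceAs (Module K (OrderedForest C →₀ K))

/-- The basis of ordered forests. -/
noncomputable def basis : Module.Basis (OrderedForest C) K (MKW K C) :=
  ⟨LinearEquiv.refl K (OrderedForest C →₀ K)⟩

/-- A forest as an element of the vector space that it spans. -/
noncomputable def forest (ω : OrderedForest C) : MKW K C := basis K ω

/-- The unit is the empty forest. -/
noncomputable instance : One (MKW K C) := ⟨forest K []⟩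

/-- The product of the Hopf algebra: the shuffle of ordered forests. -/
noncomputable def shuffle : MKW K C →ₗ[K] MKW K C →ₗ[K] MKW K C :=
  (basis K).constr K fun ω₁ => (basis K).constr K fun ω₂ =>
    ((shuffles ω₁ ω₂).map (forest K)).sum

/-- The pruned part of a left-admissible cut: the forests that are cut off from the different
vertices are shuffled together. -/
noncomputable def pruned (c : LeftCut C) : MKW K C :=
  c.bundles.foldl (fun z β => shuffle K z (forest K β)) (forest K c.severed)

/-- The coproduct is the sum of `P^c ⊗ T^c` over all left-admissible cuts `c`; the counit is the
coefficient of the empty forest. -/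
noncomputable instance : CoalgebraStruct K (MKW K C) where
  comul := (basis K).constr K fun ω =>
    (ω.leftCuts.map fun c => pruned K c ⊗ₜ[K] forest K c.trunk).sum
  counit := (basis K).coord []

end MKW

/-- The operator `ω₁ ⊤ ω₂ = (1/|ω₂|) ∑_v ω₁ ⊤_v ω₂`, where `v` runs over the vertices of `ω₂` and
`ω₁ ⊤_v ω₂` is obtained by grafting all roots of `ω₁` onto `v` and shuffling the new edges with those
already leaving `v`.  (For the empty forest `ω₂` the sum is empty and the value is `0`.) -/
noncomputable def MKW.growth (K : Type u) {C : Type v} [Field K] :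
    MKW K C →ₗ[K] MKW K C →ₗ[K] MKW K C :=
  (MKW.basis K).constr K fun ω₁ => (MKW.basis K).constr K fun ω₂ =>
    (ω₂.numVertices : K)⁻¹ • ((OrderedForest.grafts ω₁ ω₂).map (MKW.forest K)).sum

/-! ### Recursions at the right end of a forest -/

namespace OrderedForest

variable {C : Type u}

/-! Everything is computed at the right end of a forest. Let B(x, y) be the forest x followed by a
tree with root a and branches y, extended bilinearly (`appendNode`). Cutting off the last root
forces all other roots to be cut, so Δ B(x, y) = B(x, y) ⊗ 1 + x'y' ⊗ B(x'', y''), where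
juxtaposition is the shuffle product (`comul_appendNode`). Shuffling and grafting obey similar
recursions. Induction then gives the bialgebra axioms and, for the sum x ▷ y of all graftings, Δ(x ▷
y) = (x ▷ y') ⊗ y'' + x'y' ⊗ (x'' ▷ y'') (`comul_graft`).

Two cases of this formula matter. For primitive y it becomes (x ▷ y) ⊗ 1 + x' ⊗ (x'' ▷ y), because x
▷ 1 = 0. For x = 1, the operator 1 ▷ - multiplies a forest by its number of vertices, and the
formula says that Δ is graded. In characteristic zero, dividing by the degree therefore preserves
primitives, so ⊤ is a natural growth operator, with 1 ⊤ y = y whenever ε(y) = 0.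

The rest is formal: it combines this with coassociativity and the fact that Δ̂ of a nonempty forest
involves only smaller nonempty forests. The recursion for π is well founded. It yields primitive
values, π(x ⊤ p) = ε(x) p for primitive p, and, with the full coproduct, x = x' ⊤ π(x'') when ε(x) =
0. These two identities say that G(x) = ε(x) ∅ + G(x') · π(x''), the dot appending a last letter, is
a two-sided inverse of p₁ ⊗ ⋯ ⊗ pₙ ↦ p₁ ⊤ ⋯ ⊤ pₙ. That this map respects coproducts is the natural
growth law read as a recursion for deconcatenation at the last letter. -/

theorem numVertices_append_node (ω ch : OrderedForest C) (a : C) :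
    numVertices (ω ++ [.node a ch]) = numVertices ω + numVertices ch + 1 := by
  induction ω with
  | nil => simp [numVertices]; omega
  | cons t ω ih =>
    obtain ⟨b, ch'⟩ := t
    simp only [List.cons_append, numVertices, ih]
    omega

theorem eq_nil_of_numVertices_eq_zero {ω : OrderedForest C} (h : numVertices ω = 0) : ω = [] := by
  cases ω with
  | nil => rfl
  | cons t ω => obtain ⟨b, ch'⟩ := t; simp [numVertices] at h

/-- Every nonempty forest arises in a unique way from a forest `ω` by adding a last tree, and that
tree is given by the decoration of its root and the forest `ch` growing on the root. -/
theorem induction_append {p : OrderedForest C → Prop} (nil : p [])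
    (append_node : ∀ a ω ch, p ω → p ch → p (ω ++ [.node a ch])) (ω : OrderedForest C) : p ω := by
  induction h : numVertices ω using Nat.strong_induction_on generalizing ω with
  | _ n ih =>
    rcases List.eq_nil_or_concat ω with rfl | ⟨ω, ⟨a, ch⟩, rfl⟩
    · exact nil
    · rw [List.concat_eq_append, numVertices_append_node] at h
      rw [List.concat_eq_append]
      exact append_node a ω ch (ih _ (by omega) _ rfl) (ih _ (by omega) _ rfl)

theorem grafts_append_node (x ω ch : OrderedForest C) (a : C) :
    grafts x (ω ++ [.node a ch]) =
      (grafts x ω).map (· ++ [.node a ch]) ++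
      ((shuffles x ch).map (fun ch' => ω ++ [.node a ch']) ++
      (grafts x ch).map (fun ch' => ω ++ [.node a ch'])) := by
  induction ω with
  | nil => simp [grafts]
  | cons t ω ih =>
    obtain ⟨b, ch'⟩ := t
    simp only [List.cons_append, grafts, ih]
    simp [Function.comp_def]

/-- If the last root is cut off, left-admissibility cuts off every root, which leaves one cut.
Otherwise the cuts of `ω` and `ch` are independent, so the filter needed at the left end disappears.
-/
theorem leftCuts_append_node (ω ch : OrderedForest C) (a : C) :
    leftCuts (ω ++ [.node a ch]) =
      ⟨ω ++ [.node a ch], [], []⟩ ::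
      (leftCuts ω).flatMap (fun d => (leftCuts ch).map (fun c =>
        ⟨d.severed, d.bundles ++ (c.severed :: c.bundles), d.trunk ++ [.node a c.trunk]⟩)) := by
  induction ω with
  | nil => simp [leftCuts, ← List.map_eq_flatMap]
  | cons t ω ih =>
    obtain ⟨b, ch'⟩ := t
    simp only [List.cons_append, leftCuts, ih]
    simp only [List.map_cons, List.cons_append, List.map_flatMap, List.map_map, List.flatMap_append,
      List.flatMap_map, List.flatMap_assoc, Function.comp_def]
    congr 3
    funext c
    -- The total cut of the remaining forest severs a root, so it is incompatible with keeping the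
    -- first tree.
    rw [List.filter_cons_of_neg (by simp), List.filter_flatMap, List.map_flatMap]
    induction leftCuts ω with
    | nil => simp
    | cons d l ihl =>
      rw [List.flatMap_cons, ihl, List.filter_map]
      by_cases hd : d.severed.isEmpty
      · simp [Function.comp_def, hd]
      · simp [Function.comp_def, hd]

end OrderedForest

/-! ### Shuffles of words -/

theorem shuffles_nil_right {α : Type u} (w : List α) : shuffles w [] = [w] := by
  cases w <;> simp [shuffles]

theorem shuffles_perm_comm {α : Type u} (x y : List α) : (shuffles x y).Perm (shuffles y x) := by
  induction x generalizing y with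
  | nil => simp [shuffles_nil_right, shuffles]
  | cons a x ihx =>
    induction y with
    | nil => simp [shuffles]
    | cons b y ihy =>
      simp only [shuffles]
      exact (((ihx _).map _).append (ihy.map _)).trans List.perm_append_comm

/-- The last letter of a shuffle is one of the two last letters. The lists are generated from the
left, hence equality only up to reordering. -/
theorem shuffles_append_singleton {α : Type u} (a b : α) (x y : List α) :
    (shuffles (x ++ [a]) (y ++ [b])).Perm
      ((shuffles x (y ++ [b])).map (· ++ [a]) ++ (shuffles (x ++ [a]) y).map (· ++ [b])) := by
  induction x generalizing y with
  | nil =>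
    induction y with
    | nil => simp [shuffles, List.Perm.swap]
    | cons c y ih =>
      simp only [List.nil_append, List.cons_append, shuffles, List.map_cons, List.map_nil,
        List.map_map] at ih ⊢
      refine ((ih.map (c :: ·)).cons _).trans ?_
      simp only [List.map_cons, List.map_map]
      refine (List.Perm.swap _ _ _).trans (List.Perm.of_eq ?_)
      simp [Function.comp_def]
  | cons d x ihx =>
    induction y with
    | nil =>
      have := ihx []
      simp only [List.nil_append, List.cons_append, shuffles, List.map_append, List.map_cons,
        List.map_nil, List.map_map, shuffles_nil_right] at this ⊢
      refine ((this.map (d :: ·)).append_right _).trans ?_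
      simp only [List.map_append, List.map_map, List.append_assoc, List.map_cons, List.map_nil]
      refine List.Perm.append (List.Perm.of_eq ?_) ?_
      · simp [Function.comp_def]
      · exact List.Perm.swap _ _ _
    | cons c y ihy =>
      have h := ihx (c :: y)
      simp only [List.cons_append, shuffles, List.map_append, List.map_map] at h ihy ⊢
      refine ((h.map (d :: ·)).append (ihy.map (c :: ·))).trans ?_
      simp only [List.map_append, List.map_map, List.append_assoc, Function.comp_def,
        List.cons_append]
      refine List.Perm.append_left _ ?_
      rw [← List.append_assoc, ← List.append_assoc]
      exact List.perm_append_comm.append_right _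

/-! ### The commutative shuffle algebra -/

namespace MKW

variable (K : Type u) {C : Type v} [CommRing K]

theorem basis_apply (ω : OrderedForest C) : basis K ω = forest K ω := rfl

theorem one_eq : (1 : MKW K C) = forest K [] := rfl

variable {K} in
theorem hom_ext {M : Type*} [AddCommGroup M] [Module K M] {f g : MKW K C →ₗ[K] M}
    (h : ∀ ω, f (forest K ω) = g (forest K ω)) : f = g :=
  (basis K).ext h

theorem shuffle_forest (x y : OrderedForest C) :
    shuffle K (forest K x) (forest K y) = ((shuffles x y).map (forest K)).sum := by
  simp [shuffle, ← basis_apply]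

/-- Putting a tree in front of a forest. -/
noncomputable def consTree (t : PlanarTree C) : MKW K C →ₗ[K] MKW K C :=
  (basis K).constr K fun ω => forest K (t :: ω)

theorem consTree_forest (t : PlanarTree C) (ω : OrderedForest C) :
    consTree K t (forest K ω) = forest K (t :: ω) := by
  simp [consTree, ← basis_apply]

theorem shuffle_comm (x y : MKW K C) : shuffle K x y = shuffle K y x := by
  suffices h : shuffle K (C := C) = (shuffle K).flip from congr($h x y)
  refine hom_ext fun ω₁ => hom_ext fun ω₂ => ?_
  rw [LinearMap.flip_apply, shuffle_forest, shuffle_forest]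
  exact ((shuffles_perm_comm _ _).map _).sum_eq

theorem one_shuffle (x : MKW K C) : shuffle K 1 x = x := by
  suffices h : shuffle K (1 : MKW K C) = LinearMap.id from congr($h x)
  refine hom_ext fun ω => ?_
  simp [one_eq, shuffle_forest, shuffles]

theorem shuffle_consTree (s t : PlanarTree C) (x y : MKW K C) :
    shuffle K (consTree K s x) (consTree K t y) =
      consTree K s (shuffle K x (consTree K t y)) +
        consTree K t (shuffle K (consTree K s x) y) := by
  suffices h : (shuffle K).compl₁₂ (consTree K s) (consTree K t) =
      ((shuffle K).compl₁₂ LinearMap.id (consTree K t)).compr₂ (consTree K s) +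
      ((shuffle K).compl₁₂ (consTree K s) LinearMap.id).compr₂ (consTree K t) from congr($h x y)
  refine hom_ext fun ω₁ => hom_ext fun ω₂ => ?_
  simp [consTree_forest, shuffle_forest, shuffles, map_list_sum, Function.comp_def]

theorem shuffle_assoc (x y z : MKW K C) :
    shuffle K (shuffle K x y) z = shuffle K x (shuffle K y z) := by
  suffices h : (shuffle K (C := C)).compr₂ (shuffle K) =
      ((LinearMap.llcomp K _ _ _).flip.comp (shuffle K)).flip.comp (shuffle K) from
    congr($h x y z)
  refine hom_ext fun ω₁ => hom_ext fun ω₂ => hom_ext fun ω₃ => ?_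
  change shuffle K (shuffle K (forest K ω₁) (forest K ω₂)) (forest K ω₃) =
    shuffle K (forest K ω₁) (shuffle K (forest K ω₂) (forest K ω₃))
  induction ω₁ generalizing ω₂ ω₃ with
  | nil => rw [← one_eq, one_shuffle, one_shuffle]
  | cons r ω₁ ih₁ =>
    induction ω₂ generalizing ω₃ with
    | nil => rw [← one_eq, one_shuffle, shuffle_comm K _ 1, one_shuffle]
    | cons s ω₂ ih₂ =>
      induction ω₃ with
      | nil => rw [← one_eq, shuffle_comm K _ 1, shuffle_comm K _ 1, one_shuffle, one_shuffle]
      | cons t ω₃ ih₃ =>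
        have h₁ := ih₁ (s :: ω₂) (t :: ω₃)
        have h₂ := ih₂ (t :: ω₃)
        simp only [← consTree_forest] at h₁ h₂ ih₃ ⊢
        simp only [shuffle_consTree, map_add, LinearMap.add_apply] at h₁ h₂ ih₃ ⊢
        -- The three hypotheses account for the terms that begin with `r`, `s` and `t` respectively.
        rw [h₁, h₂, ← ih₃]
        simp only [map_add]
        abel

/-- The shuffle product turns the span of the ordered forests into a commutative ring. -/
noncomputable abbrev commRing : CommRing (MKW K C) where
  __ := instAddCommGroup K
  mul x y := shuffle K x y
  one := 1
  mul_assoc := shuffle_assoc K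
  mul_comm := shuffle_comm K
  one_mul := one_shuffle K
  mul_one x := (shuffle_comm K x 1).trans (one_shuffle K x)
  zero_mul x := (shuffle K).map_zero₂ x
  mul_zero x := map_zero (shuffle K x)
  left_distrib x := map_add (shuffle K x)
  right_distrib := (shuffle K).map_add₂

attribute [local instance] commRing

/-- The shuffle algebra. -/
noncomputable abbrev algebra : Algebra K (MKW K C) :=
  Algebra.ofModule (fun r => (shuffle K).map_smul₂ r) (fun r x => map_smul (shuffle K x) r)

attribute [local instance] algebra

theorem shuffle_eq_mul (x y : MKW K C) : shuffle K x y = x * y := rfl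

end MKW

/-! ### The bialgebra structure and its interaction with grafting -/

namespace MKW

section HopfAlgebra

variable (K : Type u) {C : Type v} [CommRing K]

attribute [local instance] commRing algebra

open CoalgebraStruct

variable {K} in
theorem induction_linear {p : MKW K C → Prop} (x : MKW K C) (zero : p 0)
    (add : ∀ x y, p x → p y → p (x + y)) (smul_forest : ∀ (r : K) ω, p (r • forest K ω)) : p x := by
  refine Finsupp.induction_linear x zero add fun ω r => ?_
  have h : (Finsupp.single ω r : MKW K C) = r • forest K ω := by
    rw [← Finsupp.smul_single_one]; rfl
  exact h ▸ smul_forest r ω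

/-- Turns a sum over independent pairs of cuts into a product of two coproducts. -/
theorem sum_flatMap_bilin {α β M N P : Type*} [AddCommGroup M] [AddCommGroup N] [AddCommGroup P]
    [Module K M] [Module K N] [Module K P] (B : M →ₗ[K] N →ₗ[K] P) (f : α → M) (g : β → N)
    (l : List α) (l' : List β) :
    (l.flatMap fun a => l'.map fun b => B (f a) (g b)).sum = B (l.map f).sum (l'.map g).sum := by
  induction l with
  | nil => simp
  | cons a l ih =>
    simp [List.flatMap_cons, ih, map_list_sum, Function.comp_def]

/-! #### Adding a last tree -/

/-- Adding to a forest `ω` the last tree whose root is decorated by `a` and carries the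
forest `ch`. -/
noncomputable def appendNode (a : C) : MKW K C →ₗ[K] MKW K C →ₗ[K] MKW K C :=
  (basis K).constr K fun ω => (basis K).constr K fun ch => forest K (ω ++ [.node a ch])

theorem appendNode_forest (a : C) (ω ch : OrderedForest C) :
    appendNode K a (forest K ω) (forest K ch) = forest K (ω ++ [.node a ch]) := by
  simp [appendNode, ← basis_apply]

theorem appendNode_list_sum {α : Type*} (a : C) (l : List α) (f : α → MKW K C) (x : MKW K C) :
    appendNode K a (l.map f).sum x = (l.map fun i => appendNode K a (f i) x).sum := by
  rw [← LinearMap.flip_apply, map_list_sum, List.map_map]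
  rfl

theorem appendNode_mul_appendNode (a b : C) (x y z w : MKW K C) :
    appendNode K a x y * appendNode K b z w =
      appendNode K a (x * appendNode K b z w) y + appendNode K b (appendNode K a x y * z) w := by
  induction x using induction_linear with
  | zero => simp
  | add x x' h h' => simp only [map_add, LinearMap.add_apply, add_mul, h, h']; abel
  | smul_forest r ω₁ =>
  induction y using induction_linear with
  | zero => simp
  | add x x' h h' => simp only [map_add, LinearMap.add_apply, add_mul, h, h']; abel
  | smul_forest r' ω₂ =>
  induction z using induction_linear with
  | zero => simp
  | add x x' h h' => simp only [map_add, LinearMap.add_apply, mul_add, h, h']; abel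
  | smul_forest s ω₃ =>
  induction w using induction_linear with
  | zero => simp
  | add x x' h h' => simp only [map_add, LinearMap.add_apply, mul_add, h, h']; abel
  | smul_forest s' ω₄ =>
  have h : appendNode K a (forest K ω₁) (forest K ω₂) * appendNode K b (forest K ω₃) (forest K ω₄) =
      appendNode K a (forest K ω₁ * appendNode K b (forest K ω₃) (forest K ω₄)) (forest K ω₂) +
        appendNode K b (appendNode K a (forest K ω₁) (forest K ω₂) * forest K ω₃) (forest K ω₄) := by
    simp only [← shuffle_eq_mul, appendNode_forest, shuffle_forest, appendNode_list_sum,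
      ((shuffles_append_singleton _ _ _ _).map (forest K)).sum_eq, List.map_append, List.sum_append,
      List.map_map, Function.comp_def]
  simp only [map_smul, LinearMap.smul_apply, smul_mul_assoc, mul_smul_comm, h]
  module

theorem pruned_eq (c : LeftCut C) :
    pruned K c = forest K c.severed * (c.bundles.map (forest K)).prod := by
  rw [pruned]
  generalize forest K c.severed = x
  induction c.bundles generalizing x with
  | nil => simp
  | cons b l ih => rw [List.foldl_cons, ih, shuffle_eq_mul, List.map_cons, List.prod_cons, mul_assoc]

theorem comul_forest (ω : OrderedForest C) :
    comul (R := K) (forest K ω) = (ω.leftCuts.map fun c => pruned K c ⊗ₜ[K] forest K c.trunk).sum := by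
  simp [comul, ← basis_apply]

theorem comul_one : comul (R := K) (1 : MKW K C) = 1 ⊗ₜ 1 := by
  rw [one_eq, comul_forest]
  simp [OrderedForest.leftCuts, pruned]

/-- The product on the left and `appendNode` on the right tensor factor. -/
noncomputable def mulAppendNode (a : C) :
    MKW K C ⊗[K] MKW K C →ₗ[K] MKW K C ⊗[K] MKW K C →ₗ[K] MKW K C ⊗[K] MKW K C :=
  TensorProduct.map₂ (LinearMap.mul K _) (appendNode K a)

theorem mulAppendNode_tmul (a : C) (x y z w : MKW K C) :
    mulAppendNode K a (x ⊗ₜ y) (z ⊗ₜ w) = (x * z) ⊗ₜ appendNode K a y w := rfl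

/-- The coproduct is determined by the recursion for the right-most tree: this tree is either cut
off together with everything else or remains. -/
theorem comul_appendNode (a : C) (x y : MKW K C) :
    comul (R := K) (appendNode K a x y) =
      appendNode K a x y ⊗ₜ 1 + mulAppendNode K a (comul (R := K) x) (comul (R := K) y) := by
  induction x using induction_linear with
  | zero => simp
  | add x x' h h' =>
    simp only [map_add, LinearMap.add_apply, TensorProduct.add_tmul, h, h']; abel
  | smul_forest r ω =>
  induction y using induction_linear with
  | zero => simp
  | add x x' h h' =>
    simp only [map_add, TensorProduct.add_tmul, h, h']; abel
  | smul_forest s ch =>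
  simp only [map_smul, LinearMap.smul_apply, ← TensorProduct.smul_tmul', ← smul_add]
  congr 2
  rw [appendNode_forest, comul_forest, OrderedForest.leftCuts_append_node, comul_forest,
    comul_forest, ← sum_flatMap_bilin, List.map_cons, List.sum_cons, List.map_flatMap]
  refine congrArg₂ _ ?_ ?_
  · simp [pruned, one_eq]
  · simp only [List.map_map, Function.comp_def, mulAppendNode_tmul, appendNode_forest, pruned_eq,
      List.map_append, List.map_cons, List.prod_append, List.prod_cons, mul_assoc]

/-! ### Counit laws -/

theorem counit_one : counit (R := K) (1 : MKW K C) = 1 := by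
  simp [counit, one_eq, ← basis_apply]

theorem counit_appendNode (a : C) (x y : MKW K C) :
    counit (R := K) (appendNode K a x y) = 0 := by
  suffices h : (appendNode K a).compr₂ (counit (R := K) (A := MKW K C)) = 0 from congr($h x y)
  refine hom_ext fun ω₁ => hom_ext fun ω₂ => ?_
  rw [LinearMap.compr₂_apply, appendNode_forest]
  simp [counit, ← basis_apply]

theorem counit_mul (x y : MKW K C) :
    counit (R := K) (x * y) = counit (R := K) x * counit (R := K) y := by
  suffices h : (LinearMap.mul K (MKW K C)).compr₂ (counit (R := K)) =
    (LinearMap.mul K K).compl₁₂ (counit (R := K)) (counit (R := K)) from congr($h x y)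
  refine hom_ext fun ω₁ => hom_ext fun ω₂ => ?_
  change counit (R := K) (forest K ω₁ * forest K ω₂) =
    counit (R := K) (forest K ω₁) * counit (R := K) (forest K ω₂)
  induction ω₁ using OrderedForest.induction_append with
  | nil =>
    rw [← one_eq]
    rw [one_mul, counit_one, one_mul]
  | append_node a u v _ _ =>
    rw [← appendNode_forest]
    induction ω₂ using OrderedForest.induction_append with
    | nil =>
    rw [← one_eq]
    rw [mul_one, counit_one, mul_one]
    | append_node b w z _ _ =>
      rw [← appendNode_forest]
      rw [appendNode_mul_appendNode, map_add]
      simp [counit_appendNode]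

theorem rTensor_counit_mulAppendNode (a : C) (X Y : MKW K C ⊗[K] MKW K C) :
    TensorProduct.lid K _ ((counit (R := K)).rTensor _ (mulAppendNode K a X Y)) =
      appendNode K a (TensorProduct.lid K _ ((counit (R := K)).rTensor _ X))
        (TensorProduct.lid K _ ((counit (R := K)).rTensor _ Y)) := by
  induction X with
  | zero => simp
  | add x x' h h' => simp only [map_add, LinearMap.add_apply, h, h']
  | tmul x x' =>
  induction Y with
  | zero => simp
  | add x x' h h' => simp only [map_add, h, h']
  | tmul y y' =>
    simp only [mulAppendNode_tmul, LinearMap.rTensor_tmul, TensorProduct.lid_tmul, counit_mul,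
      map_smul, LinearMap.smul_apply, mul_smul, smul_comm (counit (R := K) x)]

theorem lTensor_counit_mulAppendNode (a : C) (X Y : MKW K C ⊗[K] MKW K C) :
    (counit (R := K)).lTensor _ (mulAppendNode K a X Y) = 0 := by
  induction X with
  | zero => simp
  | add x x' h h' => simp only [map_add, LinearMap.add_apply, h, h', add_zero]
  | tmul x x' =>
  induction Y with
  | zero => simp
  | add x x' h h' => simp only [map_add, h, h', add_zero]
  | tmul y y' => simp [mulAppendNode_tmul, counit_appendNode]

theorem rTensor_counit_comul (x : MKW K C) :
    TensorProduct.lid K _ ((counit (R := K)).rTensor _ (comul (R := K) x)) = x := by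
  suffices h : (TensorProduct.lid K _).toLinearMap ∘ₗ (counit (R := K)).rTensor _ ∘ₗ
    comul (R := K) (A := MKW K C) = LinearMap.id from congr($h x)
  refine hom_ext fun ω => ?_
  simp only [LinearMap.comp_apply, LinearEquiv.coe_coe, LinearMap.id_apply]
  induction ω using OrderedForest.induction_append with
  | nil =>
    rw [← one_eq]
    simp [comul_one, counit_one]
  | append_node a u v hu hv =>
    rw [← appendNode_forest]
    rw [comul_appendNode, map_add, map_add, rTensor_counit_mulAppendNode, hu, hv]
    simp [counit_appendNode]

theorem lTensor_counit_comul (x : MKW K C) :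
    TensorProduct.rid K _ ((counit (R := K)).lTensor _ (comul (R := K) x)) = x := by
  suffices h : (TensorProduct.rid K _).toLinearMap ∘ₗ (counit (R := K)).lTensor _ ∘ₗ
    comul (R := K) (A := MKW K C) = LinearMap.id from congr($h x)
  refine hom_ext fun ω => ?_
  simp only [LinearMap.comp_apply, LinearEquiv.coe_coe, LinearMap.id_apply]
  induction ω using OrderedForest.induction_append with
  | nil =>
    rw [← one_eq]
    simp [comul_one, counit_one]
  | append_node a u v hu hv =>
    rw [← appendNode_forest]
    rw [comul_appendNode, map_add, map_add, lTensor_counit_mulAppendNode]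
    simp [counit_one]

/-! ### Multiplicativity of the coproduct and coassociativity -/

theorem mulAppendNode_mul_mulAppendNode (a b : C) (X Y Z W : MKW K C ⊗[K] MKW K C) :
    mulAppendNode K a X Y * mulAppendNode K b Z W =
      mulAppendNode K a (X * mulAppendNode K b Z W) Y +
        mulAppendNode K b (mulAppendNode K a X Y * Z) W := by
  induction X with
  | zero => simp
  | add x x' h h' => simp only [map_add, LinearMap.add_apply, add_mul, h, h']; abel
  | tmul x x' =>
  induction Y with
  | zero => simp
  | add x x' h h' => simp only [map_add, LinearMap.add_apply, add_mul, h, h']; abel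
  | tmul y y' =>
  induction Z with
  | zero => simp
  | add x x' h h' => simp only [map_add, LinearMap.add_apply, mul_add, h, h']; abel
  | tmul z z' =>
  induction W with
  | zero => simp
  | add x x' h h' => simp only [map_add, LinearMap.add_apply, mul_add, h, h']; abel
  | tmul w w' =>
    simp only [mulAppendNode_tmul, Algebra.TensorProduct.tmul_mul_tmul, appendNode_mul_appendNode,
      TensorProduct.tmul_add]
    refine congrArg₂ _ (congrArg₂ _ ?_ rfl) (congrArg₂ _ ?_ rfl) <;> ring

theorem mulAppendNode_mul_tmul_one (a : C) (x : MKW K C) (X Y : MKW K C ⊗[K] MKW K C) :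
    mulAppendNode K a X Y * x ⊗ₜ 1 = mulAppendNode K a (X * x ⊗ₜ 1) Y := by
  induction X with
  | zero => simp
  | add x x' h h' => simp only [map_add, LinearMap.add_apply, add_mul, h, h']
  | tmul z z' =>
  induction Y with
  | zero => simp
  | add x x' h h' => simp only [map_add, add_mul, h, h']
  | tmul y y' =>
    simp only [mulAppendNode_tmul, Algebra.TensorProduct.tmul_mul_tmul, mul_one]
    congr 1; ring

theorem tmul_one_mul_mulAppendNode (a : C) (x : MKW K C) (X Y : MKW K C ⊗[K] MKW K C) :
    x ⊗ₜ 1 * mulAppendNode K a X Y = mulAppendNode K a (x ⊗ₜ 1 * X) Y := by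
  rw [mul_comm, mulAppendNode_mul_tmul_one, mul_comm]

/-- The coproduct is multiplicative for the shuffle product. -/
theorem comul_mul (x y : MKW K C) :
    comul (R := K) (x * y) = comul (R := K) x * comul (R := K) y := by
  suffices h : (LinearMap.mul K (MKW K C)).compr₂ (comul (R := K)) =
    (LinearMap.mul K (MKW K C ⊗[K] MKW K C)).compl₁₂ (comul (R := K)) (comul (R := K)) from
    congr($h x y)
  refine hom_ext fun ω₁ => hom_ext fun ω₂ => ?_
  change comul (R := K) (forest K ω₁ * forest K ω₂) =
    comul (R := K) (forest K ω₁) * comul (R := K) (forest K ω₂)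
  induction ω₁ using OrderedForest.induction_append generalizing ω₂ with
  | nil =>
    rw [← one_eq]
    rw [one_mul, comul_one, ← Algebra.TensorProduct.one_def, one_mul]
  | append_node a u v hu _ =>
    rw [← appendNode_forest]
    induction ω₂ using OrderedForest.induction_append with
    | nil =>
    rw [← one_eq]
    rw [mul_one, comul_one, ← Algebra.TensorProduct.one_def, mul_one]
    | append_node b w z hw _ =>
      rw [← appendNode_forest]
      -- The recursion for the product shortens one factor and keeps the other whole, so `u` has to
      -- be paired with the entire second forest.
      have hu' := hu (w ++ [.node b z])
      rw [← appendNode_forest] at hu'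
      rw [appendNode_mul_appendNode, map_add, comul_appendNode, comul_appendNode K b, hu', hw,
        comul_appendNode K a, comul_appendNode K b]
      simp only [mul_add, add_mul, map_add, LinearMap.add_apply, mulAppendNode_mul_mulAppendNode,
        mulAppendNode_mul_tmul_one, tmul_one_mul_mulAppendNode,
        Algebra.TensorProduct.tmul_mul_tmul, mul_one, appendNode_mul_appendNode,
        TensorProduct.add_tmul]
      abel

/-- The product on the first and `mulAppendNode` on the other two tensor factors. -/
noncomputable def mulMulAppendNode (a : C) :
    MKW K C ⊗[K] (MKW K C ⊗[K] MKW K C) →ₗ[K] MKW K C ⊗[K] (MKW K C ⊗[K] MKW K C) →ₗ[K]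
      MKW K C ⊗[K] (MKW K C ⊗[K] MKW K C) :=
  TensorProduct.map₂ (LinearMap.mul K _) (mulAppendNode K a)

theorem mulMulAppendNode_tmul (a : C) (x y : MKW K C) (X Y : MKW K C ⊗[K] MKW K C) :
    mulMulAppendNode K a (x ⊗ₜ X) (y ⊗ₜ Y) = (x * y) ⊗ₜ mulAppendNode K a X Y := rfl

theorem assoc_mul_tmul_appendNode (a : C) (X Y : MKW K C ⊗[K] MKW K C) (x y : MKW K C) :
    TensorProduct.assoc K _ _ _ ((X * Y) ⊗ₜ[K] appendNode K a x y) =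
      mulMulAppendNode K a (TensorProduct.assoc K _ _ _ (X ⊗ₜ x))
        (TensorProduct.assoc K _ _ _ (Y ⊗ₜ y)) := by
  induction X with
  | zero => simp
  | add x x' h h' =>
    simp only [map_add, LinearMap.add_apply, add_mul, TensorProduct.add_tmul, h, h']
  | tmul z z' =>
  induction Y with
  | zero => simp
  | add x x' h h' =>
    simp only [map_add, mul_add, TensorProduct.add_tmul, h, h']
  | tmul y y' => simp [mulMulAppendNode_tmul, mulAppendNode_tmul]

/-- This is where coassociativity uses that Δ is multiplicative: the left tensor factor is a shuffle
product. -/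
theorem rTensor_comul_mulAppendNode (a : C) (X Y : MKW K C ⊗[K] MKW K C) :
    TensorProduct.assoc K _ _ _ ((comul (R := K)).rTensor _ (mulAppendNode K a X Y)) =
      mulMulAppendNode K a (TensorProduct.assoc K _ _ _ ((comul (R := K)).rTensor _ X))
        (TensorProduct.assoc K _ _ _ ((comul (R := K)).rTensor _ Y)) := by
  induction X with
  | zero => simp
  | add x x' h h' => simp only [map_add, LinearMap.add_apply, h, h']
  | tmul z z' =>
  induction Y with
  | zero => simp
  | add x x' h h' => simp only [map_add, h, h']
  | tmul y y' =>
    rw [mulAppendNode_tmul, LinearMap.rTensor_tmul, comul_mul, assoc_mul_tmul_appendNode]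
    rfl

theorem lTensor_comul_mulAppendNode (a : C) (X Y : MKW K C ⊗[K] MKW K C) :
    (comul (R := K)).lTensor _ (mulAppendNode K a X Y) =
      TensorProduct.assoc K _ _ _ (mulAppendNode K a X Y ⊗ₜ 1) +
        mulMulAppendNode K a ((comul (R := K)).lTensor _ X) ((comul (R := K)).lTensor _ Y) := by
  induction X with
  | zero => simp
  | add x x' h h' =>
    simp only [map_add, LinearMap.add_apply, TensorProduct.add_tmul, h, h']; abel
  | tmul z z' =>
  induction Y with
  | zero => simp
  | add x x' h h' => simp only [map_add, TensorProduct.add_tmul, h, h']; abel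
  | tmul y y' =>
    rw [mulAppendNode_tmul, LinearMap.lTensor_tmul, comul_appendNode, TensorProduct.tmul_add]
    rfl

/-- Both iterated coproducts satisfy the same recursion under adding a last tree. -/
theorem coassoc (x : MKW K C) :
    TensorProduct.assoc K _ _ _ ((comul (R := K)).rTensor _ (comul (R := K) x)) =
      (comul (R := K)).lTensor _ (comul (R := K) x) := by
  suffices h : (TensorProduct.assoc K _ _ _).toLinearMap ∘ₗ (comul (R := K)).rTensor _ ∘ₗ
    comul (R := K) (A := MKW K C) = (comul (R := K)).lTensor _ ∘ₗ comul (R := K) from congr($h x)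
  refine hom_ext fun ω => ?_
  simp only [LinearMap.comp_apply, LinearEquiv.coe_coe]
  induction ω using OrderedForest.induction_append with
  | nil =>
    rw [← one_eq]
    simp [comul_one]
  | append_node a u v hu hv =>
    rw [← appendNode_forest]
    rw [comul_appendNode, map_add, map_add, map_add, rTensor_comul_mulAppendNode,
      lTensor_comul_mulAppendNode, hu, hv, LinearMap.rTensor_tmul, comul_appendNode,
      TensorProduct.add_tmul, map_add, LinearMap.lTensor_tmul, comul_one, add_assoc]
    rfl

/-! #### Grafting -/

/-- The sum, over the vertices of the second forest, of all graftings of the first forest. -/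
noncomputable def graft : MKW K C →ₗ[K] MKW K C →ₗ[K] MKW K C :=
  (basis K).constr K fun ω₁ => (basis K).constr K fun ω₂ =>
    ((OrderedForest.grafts ω₁ ω₂).map (forest K)).sum

theorem graft_forest (ω₁ ω₂ : OrderedForest C) :
    graft K (forest K ω₁) (forest K ω₂) = ((OrderedForest.grafts ω₁ ω₂).map (forest K)).sum := by
  simp [graft, ← basis_apply]

theorem graft_one (x : MKW K C) : graft K x 1 = 0 := by
  suffices h : (graft K (C := C)).flip 1 = 0 from congr($h x)
  refine hom_ext fun ω => ?_
  rw [LinearMap.flip_apply, one_eq, graft_forest]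
  simp [OrderedForest.grafts]

/-- The grafting vertex lies in `y`, is the new root (which shuffles `x` with `z`), or lies in `z`.
-/
theorem graft_appendNode (a : C) (x y z : MKW K C) :
    graft K x (appendNode K a y z) =
      appendNode K a (graft K x y) z + appendNode K a y (x * z + graft K x z) := by
  induction x using induction_linear with
  | zero => simp
  | add x x' h h' => simp only [map_add, LinearMap.add_apply, add_mul, h, h']; abel
  | smul_forest r ω₁ =>
  induction y using induction_linear with
  | zero => simp
  | add x x' h h' => simp only [map_add, LinearMap.add_apply, h, h']; abel
  | smul_forest r' ω₂ =>
  induction z using induction_linear with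
  | zero => simp
  | add x x' h h' => simp only [map_add, mul_add, h, h']; abel
  | smul_forest s ω₃ =>
  have h : graft K (forest K ω₁) (appendNode K a (forest K ω₂) (forest K ω₃)) =
      appendNode K a (graft K (forest K ω₁) (forest K ω₂)) (forest K ω₃) +
        appendNode K a (forest K ω₂)
          (forest K ω₁ * forest K ω₃ + graft K (forest K ω₁) (forest K ω₃)) := by
    simp only [← shuffle_eq_mul, shuffle_forest, graft_forest, OrderedForest.grafts_append_node,
      List.map_append, List.sum_append, map_add, appendNode_list_sum, List.map_map,
      Function.comp_def, appendNode_forest]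
    simp only [map_list_sum, List.map_map, Function.comp_def, appendNode_forest]
  simp only [map_smul, LinearMap.smul_apply, smul_mul_assoc, mul_smul_comm, map_add, h]
  module

/-- Grafting is a derivation of the shuffle product. -/
theorem graft_mul (x y z : MKW K C) :
    graft K x (y * z) = graft K x y * z + y * graft K x z := by
  suffices h : (LinearMap.mul K (MKW K C)).compr₂ (graft K x) =
    (LinearMap.mul K (MKW K C)).comp (graft K x) +
      (LinearMap.mul K (MKW K C)).compl₂ (graft K x) from congr($h y z)
  refine hom_ext fun ω₁ => hom_ext fun ω₂ => ?_
  change graft K x (forest K ω₁ * forest K ω₂) =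
    graft K x (forest K ω₁) * forest K ω₂ + forest K ω₁ * graft K x (forest K ω₂)
  induction ω₁ using OrderedForest.induction_append generalizing ω₂ with
  | nil =>
    rw [← one_eq]
    rw [one_mul, graft_one, zero_mul, zero_add, one_mul]
  | append_node a u v hu _ =>
    rw [← appendNode_forest]
    induction ω₂ using OrderedForest.induction_append with
    | nil =>
    rw [← one_eq]
    rw [mul_one, graft_one, mul_zero, add_zero, mul_one]
    | append_node b w z hw _ =>
      rw [← appendNode_forest]
      have hu' := hu (w ++ [.node b z])
      rw [← appendNode_forest] at hu'
      rw [appendNode_mul_appendNode, map_add, graft_appendNode, graft_appendNode, hu', hw,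
        graft_appendNode, graft_appendNode]
      simp only [map_add, LinearMap.add_apply, add_mul, mul_add, appendNode_mul_appendNode]
      abel

/-- The product on the left and grafting on the right tensor factor. -/
noncomputable def mulGraft :
    MKW K C ⊗[K] MKW K C →ₗ[K] MKW K C ⊗[K] MKW K C →ₗ[K] MKW K C ⊗[K] MKW K C :=
  TensorProduct.map₂ (LinearMap.mul K _) (graft K)

theorem mulGraft_tmul (x y z w : MKW K C) :
    mulGraft K (x ⊗ₜ y) (z ⊗ₜ w) = (x * z) ⊗ₜ graft K y w := rfl

theorem rTensor_graft_mulAppendNode (a : C) (x : MKW K C) (X Y : MKW K C ⊗[K] MKW K C) :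
    (graft K x).rTensor _ (mulAppendNode K a X Y) =
      mulAppendNode K a ((graft K x).rTensor _ X) Y +
        mulAppendNode K a X ((graft K x).rTensor _ Y) := by
  induction X with
  | zero => simp
  | add x x' h h' => simp only [map_add, LinearMap.add_apply, h, h']; abel
  | tmul z z' =>
  induction Y with
  | zero => simp
  | add x x' h h' => simp only [map_add, h, h']; abel
  | tmul y y' => simp [mulAppendNode_tmul, graft_mul, TensorProduct.add_tmul]

theorem mulGraft_tmul_one (x : MKW K C) (X : MKW K C ⊗[K] MKW K C) :
    mulGraft K X (x ⊗ₜ 1) = 0 := by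
  induction X with
  | zero => simp
  | add x x' h h' => simp only [map_add, LinearMap.add_apply, h, h', add_zero]
  | tmul z z' => simp [mulGraft_tmul, graft_one]

theorem mulGraft_mulAppendNode (a : C) (X Y Z : MKW K C ⊗[K] MKW K C) :
    mulGraft K X (mulAppendNode K a Y Z) =
      mulAppendNode K a (mulGraft K X Y) Z +
        mulAppendNode K a Y (X * Z + mulGraft K X Z) := by
  induction X with
  | zero => simp
  | add x x' h h' => simp only [map_add, LinearMap.add_apply, add_mul, h, h']; abel
  | tmul z z' =>
  induction Y with
  | zero => simp
  | add x x' h h' => simp only [map_add, LinearMap.add_apply, h, h']; abel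
  | tmul y y' =>
  induction Z with
  | zero => simp
  | add x x' h h' => simp only [map_add, mul_add, h, h']; abel
  | tmul x x' =>
    simp only [mulAppendNode_tmul, mulGraft_tmul, graft_appendNode, TensorProduct.tmul_add, map_add,
      Algebra.TensorProduct.tmul_mul_tmul, mul_assoc, mul_left_comm]

/-- If the grafting vertex is pruned, all of `x` is pruned with it. If it stays in the trunk, the
cut restricts to a cut of `x`, whose pruned part is shuffled with that of `y`. The proof checks that
both sides obey the same recursion. -/
theorem comul_graft (x y : MKW K C) :
    comul (R := K) (graft K x y) =
      (graft K x).rTensor _ (comul (R := K) y) +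
        mulGraft K (comul (R := K) x) (comul (R := K) y) := by
  suffices h : comul (R := K) ∘ₗ graft K x =
    (graft K x).rTensor _ ∘ₗ comul (R := K) + mulGraft K (comul (R := K) x) ∘ₗ comul (R := K) from
    congr($h y)
  refine hom_ext fun ω => ?_
  simp only [LinearMap.comp_apply, LinearMap.add_apply]
  induction ω using OrderedForest.induction_append with
  | nil =>
    rw [← one_eq]
    rw [graft_one, comul_one, LinearMap.rTensor_tmul, graft_one, mulGraft_tmul_one]; simp
  | append_node a u v hu hv =>
    rw [← appendNode_forest]
    rw [graft_appendNode, map_add, comul_appendNode, comul_appendNode, comul_appendNode, hu,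
      map_add (comul (R := K)), hv, comul_mul]
    simp only [map_add, LinearMap.add_apply, rTensor_graft_mulAppendNode, mulGraft_tmul_one,
      mulGraft_mulAppendNode, LinearMap.rTensor_tmul, graft_appendNode, TensorProduct.add_tmul]
    abel

/-- Grafting the empty forest changes nothing, once for each vertex; so `graft K 1` is the degree
operator. -/
theorem graft_one_left (ω : OrderedForest C) :
    graft K 1 (forest K ω) = (ω.numVertices : K) • forest K ω := by
  induction ω using OrderedForest.induction_append with
  | nil => rw [← one_eq, graft_one]; simp [OrderedForest.numVertices]
  | append_node a u v hu hv =>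
    rw [← appendNode_forest, graft_appendNode, hu, hv, OrderedForest.numVertices_append_node]
    simp only [map_smul, map_add, LinearMap.smul_apply, one_mul, Nat.cast_add, add_smul,
      Nat.cast_one, one_smul]
    abel

theorem counit_graft (x y : MKW K C) : counit (R := K) (graft K x y) = 0 := by
  suffices h : counit (R := K) ∘ₗ graft K x = 0 from congr($h y)
  refine hom_ext fun ω => ?_
  rw [LinearMap.comp_apply, LinearMap.zero_apply]
  induction ω using OrderedForest.induction_append with
  | nil => rw [← one_eq, graft_one, map_zero]
  | append_node a u v _ _ =>
    rw [← appendNode_forest, graft_appendNode, map_add, counit_appendNode, counit_appendNode,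
      add_zero]

theorem mulGraft_one_tmul_one (X : MKW K C ⊗[K] MKW K C) :
    mulGraft K (1 ⊗ₜ 1) X = (graft K 1).lTensor _ X := by
  induction X with
  | zero => simp
  | add x x' h h' => simp only [map_add, h, h']
  | tmul z z' => rw [mulGraft_tmul, one_mul, LinearMap.lTensor_tmul]

theorem mulGraft_one_tmul (y : MKW K C) (X : MKW K C ⊗[K] MKW K C) :
    mulGraft K X (1 ⊗ₜ y) = ((graft K).flip y).lTensor _ X := by
  induction X with
  | zero => simp
  | add x x' h h' => simp only [map_add, LinearMap.add_apply, h, h']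
  | tmul z z' => rw [mulGraft_tmul, mul_one, LinearMap.lTensor_tmul, LinearMap.flip_apply]

end HopfAlgebra

end MKW

/-! ### The reduced coproduct, the grading, and natural growth -/

namespace MKW

open CoalgebraStruct OrderedForest

section Reduced

variable (K : Type u) {C : Type v} [CommRing K]

theorem reducedComul_apply (x : MKW K C) :
    reducedComul K x = comul (R := K) x - x ⊗ₜ 1 - 1 ⊗ₜ x := rfl

theorem comul_eq (x : MKW K C) :
    comul (R := K) x = reducedComul K x + x ⊗ₜ 1 + 1 ⊗ₜ x := by
  rw [reducedComul_apply]; abel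

variable {K} in
theorem comul_of_primitive {y : MKW K C} (hy : y ∈ primitiveElements K (MKW K C)) :
    comul (R := K) y = y ⊗ₜ 1 + 1 ⊗ₜ y := by
  rw [comul_eq, show reducedComul K y = 0 from hy, zero_add]

theorem counit_forest {ω : OrderedForest C} (h : ω ≠ []) :
    counit (R := K) (forest K ω) = 0 := by
  simp [counit, ← basis_apply, h]

variable {K} in
-- The counit law applied to y ⊗ 1 + 1 ⊗ y reads ε(y) 1 + y = y.
theorem counit_of_primitive {y : MKW K C} (hy : y ∈ primitiveElements K (MKW K C)) :
    counit (R := K) y = 0 := by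
  have h := rTensor_counit_comul K y
  rw [comul_of_primitive hy] at h
  have h' := congrArg (counit (R := K)) h
  simpa [counit_one] using h'

theorem rTensor_counit_reducedComul {x : MKW K C} (hx : counit (R := K) x = 0) :
    TensorProduct.lid K _ ((counit (R := K)).rTensor _ (reducedComul K x)) = 0 := by
  rw [reducedComul_apply, map_sub, map_sub, map_sub, map_sub, rTensor_counit_comul]
  simp [hx, counit_one]

theorem lTensor_counit_reducedComul {x : MKW K C} (hx : counit (R := K) x = 0) :
    TensorProduct.rid K _ ((counit (R := K)).lTensor _ (reducedComul K x)) = 0 := by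
  rw [reducedComul_apply, map_sub, map_sub, map_sub, map_sub, lTensor_counit_comul]
  simp [hx, counit_one]

theorem assoc_rTensor_mk_flip_one (X : MKW K C ⊗[K] MKW K C) :
    TensorProduct.assoc K _ _ _ (((TensorProduct.mk K (MKW K C) (MKW K C)).flip 1).rTensor _ X) =
      (TensorProduct.mk K (MKW K C) (MKW K C) 1).lTensor _ X := by
  induction X with
  | zero => simp
  | add x x' h h' => simp only [map_add, h, h']
  | tmul z z' => simp

theorem assoc_rTensor_mk_one (X : MKW K C ⊗[K] MKW K C) :
    TensorProduct.assoc K _ _ _ ((TensorProduct.mk K (MKW K C) (MKW K C) 1).rTensor _ X) =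
      1 ⊗ₜ X := by
  induction X with
  | zero => simp
  | add x x' h h' => simp only [map_add, TensorProduct.tmul_add, h, h']
  | tmul z z' => simp

theorem assoc_tmul_one (X : MKW K C ⊗[K] MKW K C) :
    TensorProduct.assoc K (MKW K C) (MKW K C) (MKW K C) (X ⊗ₜ 1) =
      ((TensorProduct.mk K (MKW K C) (MKW K C)).flip 1).lTensor _ X := by
  induction X with
  | zero => simp
  | add x x' h h' => simp only [map_add, TensorProduct.add_tmul, h, h']
  | tmul z z' => simp

theorem coassoc_reducedComul (x : MKW K C) :
    TensorProduct.assoc K _ _ _ ((reducedComul K).rTensor _ (reducedComul K x)) =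
      (reducedComul K).lTensor _ (reducedComul K x) := by
  have h₁ : ∀ X : MKW K C ⊗[K] MKW K C,
      TensorProduct.assoc K _ _ _ ((reducedComul K).rTensor _ X) =
        TensorProduct.assoc K _ _ _ ((comul (R := K)).rTensor _ X) -
          (TensorProduct.mk K (MKW K C) (MKW K C) 1).lTensor _ X - 1 ⊗ₜ X := fun X => by
    rw [← assoc_rTensor_mk_flip_one, ← assoc_rTensor_mk_one, ← map_sub, ← map_sub, reducedComul,
      LinearMap.rTensor_sub, LinearMap.rTensor_sub]
    rfl
  have h₂ : ∀ X : MKW K C ⊗[K] MKW K C, (reducedComul K).lTensor _ X =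
        (comul (R := K)).lTensor _ X -
          TensorProduct.assoc K (MKW K C) (MKW K C) (MKW K C) (X ⊗ₜ 1) -
          (TensorProduct.mk K (MKW K C) (MKW K C) 1).lTensor _ X := fun X => by
    rw [assoc_tmul_one, reducedComul, LinearMap.lTensor_sub, LinearMap.lTensor_sub]
    rfl
  rw [h₁, h₂, reducedComul_apply]
  simp only [map_sub, coassoc, LinearMap.rTensor_tmul, LinearMap.lTensor_tmul, comul_one,
    TensorProduct.assoc_tmul, TensorProduct.sub_tmul, TensorProduct.tmul_sub,
    TensorProduct.mk_apply]
  abel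

/-! #### The degree -/

/-- The degree operator is a coderivation, which is how the grading of Δ is expressed. -/
theorem comul_graft_one (x : MKW K C) :
    comul (R := K) (graft K 1 x) =
      (graft K 1).rTensor _ (comul (R := K) x) + (graft K 1).lTensor _ (comul (R := K) x) := by
  rw [comul_graft, comul_one, mulGraft_one_tmul_one]

theorem reducedComul_graft_one (x : MKW K C) :
    reducedComul K (graft K 1 x) =
      (graft K 1).rTensor _ (reducedComul K x) + (graft K 1).lTensor _ (reducedComul K x) := by
  rw [reducedComul_apply, reducedComul_apply, comul_graft_one]
  simp only [map_sub, LinearMap.rTensor_tmul, LinearMap.lTensor_tmul, graft_one,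
    TensorProduct.zero_tmul, TensorProduct.tmul_zero]
  abel

theorem repr_graft_one (x : MKW K C) (ω : OrderedForest C) :
    (basis K).repr (graft K 1 x) ω = ω.numVertices * (basis K).repr x ω := by
  suffices h : (basis K).coord ω ∘ₗ graft K 1 = (ω.numVertices : K) • (basis K).coord ω from
    congr($h x)
  refine hom_ext fun ω' => ?_
  rw [LinearMap.comp_apply, graft_one_left, map_smul, LinearMap.smul_apply, ← basis_apply,
    Module.Basis.coord_apply, Module.Basis.repr_self]
  by_cases h : ω' = ω
  · rw [h]
  · rw [Finsupp.single_eq_of_ne' h, smul_zero, smul_zero]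

theorem repr_degree (X : MKW K C ⊗[K] MKW K C) (a b : OrderedForest C) :
    ((basis K).tensorProduct (basis K)).repr
        ((graft K 1).rTensor _ X + (graft K 1).lTensor _ X) (a, b) =
      ((a.numVertices + b.numVertices : ℕ) : K) *
        ((basis K).tensorProduct (basis K)).repr X (a, b) := by
  induction X with
  | zero => simp
  | add x x' h h' =>
    simp only [map_add, Finsupp.add_apply, mul_add] at h h' ⊢
    rw [← h, ← h']; ring
  | tmul z z' =>
    simp only [LinearMap.rTensor_tmul, LinearMap.lTensor_tmul, map_add, Finsupp.add_apply,
      Module.Basis.tensorProduct_repr_tmul_apply, repr_graft_one, smul_eq_mul]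
    push_cast
    ring

theorem repr_nil_right (X : MKW K C ⊗[K] MKW K C) (a : OrderedForest C) :
    ((basis K).tensorProduct (basis K)).repr X (a, []) =
      (basis K).repr (TensorProduct.rid K _ ((counit (R := K)).lTensor _ X)) a := by
  induction X with
  | zero => simp
  | add x x' h h' => simp only [map_add, Finsupp.add_apply, h, h']
  | tmul z z' =>
    simp only [LinearMap.lTensor_tmul, TensorProduct.rid_tmul, map_smul, Finsupp.smul_apply,
      Module.Basis.tensorProduct_repr_tmul_apply]
    rfl

theorem repr_nil_left (X : MKW K C ⊗[K] MKW K C) (b : OrderedForest C) :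
    ((basis K).tensorProduct (basis K)).repr X ([], b) =
      (basis K).repr (TensorProduct.lid K _ ((counit (R := K)).rTensor _ X)) b := by
  induction X with
  | zero => simp
  | add x x' h h' => simp only [map_add, Finsupp.add_apply, h, h']
  | tmul z z' =>
    simp only [LinearMap.rTensor_tmul, TensorProduct.lid_tmul, map_smul, Finsupp.smul_apply,
      Module.Basis.tensorProduct_repr_tmul_apply, smul_eq_mul, mul_comm]
    rfl

theorem comul_graft_of_primitive (x : MKW K C) {y : MKW K C}
    (hy : y ∈ primitiveElements K (MKW K C)) :
    comul (R := K) (graft K x y) =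
      graft K x y ⊗ₜ 1 + ((graft K).flip y).lTensor _ (comul (R := K) x) := by
  rw [comul_graft, comul_of_primitive hy, map_add, map_add, mulGraft_tmul_one, mulGraft_one_tmul,
    LinearMap.rTensor_tmul, LinearMap.rTensor_tmul, graft_one, TensorProduct.zero_tmul, add_zero,
    zero_add]

/-- Linear maps out of the shuffle algebra can be defined by recursion on the number of vertices. -/
theorem exists_fixedPoint {M : Type*} [AddCommGroup M] [Module K M]
    (Θ : (MKW K C →ₗ[K] M) → (MKW K C →ₗ[K] M))
    (hΘ : ∀ f g ω, (∀ ω' : OrderedForest C, ω'.numVertices < ω.numVertices →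
      f (forest K ω') = g (forest K ω')) → Θ f (forest K ω) = Θ g (forest K ω)) :
    ∃ f, Θ f = f := by
  -- The iterates of `Θ` from 0 agree from stage k on at all forests with fewer than k vertices; the
  -- fixed point takes on `ω` the value of stage |ω| + 1.
  set s : ℕ → (MKW K C →ₗ[K] M) := fun k => Θ^[k] 0 with hs
  have hs' : ∀ k, s (k + 1) = Θ (s k) := fun k => Function.iterate_succ_apply' Θ k 0
  have h₁ : ∀ k ω, ω.numVertices < k → s (k + 1) (forest K ω) = s k (forest K ω) := by
    intro k
    induction k with
    | zero => intro ω h; omega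
    | succ k ih =>
      intro ω h
      rw [hs' (k + 1)]
      conv_rhs => rw [hs' k]
      exact hΘ _ _ _ fun ω' h' => ih ω' (by omega)
  have h₂ : ∀ ω k, ω.numVertices + 1 ≤ k →
      s k (forest K ω) = s (ω.numVertices + 1) (forest K ω) := by
    intro ω k h
    induction k, h using Nat.le_induction with
    | base => rfl
    | succ k hk ih => rw [h₁ k ω (by omega), ih]
  set f : MKW K C →ₗ[K] M :=
    (basis K).constr K fun ω => s (ω.numVertices + 1) (forest K ω)
  have hf : ∀ ω, f (forest K ω) = s (ω.numVertices + 1) (forest K ω) := fun ω => by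
    simp [f, ← basis_apply]
  refine ⟨f, hom_ext fun ω => ?_⟩
  rw [hf, hs']
  exact hΘ _ _ _ fun ω' h => by rw [hf, ← h₂ ω' ω.numVertices (by omega)]

end Reduced

section Growth

variable (K : Type u) {C : Type v} [Field K]

/-- Division of each nonempty forest by its number of vertices. -/
noncomputable def invDegree : MKW K C →ₗ[K] MKW K C :=
  (basis K).constr K fun ω => (ω.numVertices : K)⁻¹ • forest K ω

theorem invDegree_forest (ω : OrderedForest C) :
    invDegree K (forest K ω) = (ω.numVertices : K)⁻¹ • forest K ω := by
  simp [invDegree, ← basis_apply]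

theorem growth_eq (x y : MKW K C) : growth K x y = graft K x (invDegree K y) := by
  suffices h : growth K (C := C) = (graft K).compl₂ (invDegree K) from congr($h x y)
  refine hom_ext fun ω₁ => hom_ext fun ω₂ => ?_
  rw [LinearMap.compl₂_apply, invDegree_forest, map_smul, graft_forest]
  simp [growth, ← basis_apply]

theorem growth_flip (y : MKW K C) : (growth K).flip y = (graft K).flip (invDegree K y) :=
  LinearMap.ext fun x => growth_eq K x y

theorem counit_growth (x y : MKW K C) : counit (R := K) (growth K x y) = 0 := by
  rw [growth_eq, counit_graft]

theorem counit_invDegree (x : MKW K C) : counit (R := K) (invDegree K x) = 0 := by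
  suffices h : counit (R := K) ∘ₗ invDegree K (C := C) = 0 from congr($h x)
  refine hom_ext fun ω => ?_
  rw [LinearMap.comp_apply, invDegree_forest, map_smul, LinearMap.zero_apply]
  rcases eq_or_ne ω [] with rfl | h
  -- The empty forest is sent to 0 because 0⁻¹ = 0.
  · simp [numVertices]
  · rw [counit_forest K h, smul_zero]

variable {K} in
theorem _root_.IsRecursiveProjection.apply_primitive {π : MKW K C →ₗ[K] MKW K C}
    (hπ : IsRecursiveProjection (growth K) π) {p : MKW K C}
    (hp : p ∈ primitiveElements K (MKW K C)) : π p = p := by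
  rw [hπ.2 p (counit_of_primitive hp), show reducedComul K p = 0 from hp, map_zero, map_zero,
    sub_zero]

variable {K} in
-- Writes the term x' ⊗ (x'' ⊤ π(b)) of the natural growth law as a map applied to a threefold
-- tensor, so that coassociativity can be used.
theorem lTensor_lift_growth_assoc_tmul (π : MKW K C →ₗ[K] MKW K C)
    (X : MKW K C ⊗[K] MKW K C) (b : MKW K C) :
    (TensorProduct.lift (growth K) ∘ₗ π.lTensor _).lTensor _
        (TensorProduct.assoc K _ _ _ (X ⊗ₜ[K] b)) =
      ((growth K).flip (π b)).lTensor _ X := by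
  induction X with
  | zero => simp
  | add x x' h h' => simp only [map_add, TensorProduct.add_tmul, h, h']
  | tmul z z' => simp

variable [CharZero K]

theorem graft_one_invDegree (x : MKW K C) :
    graft K 1 (invDegree K x) = x - counit (R := K) x • 1 := by
  suffices h : graft K 1 ∘ₗ invDegree K =
    LinearMap.id - (counit (R := K)).smulRight (1 : MKW K C) from congr($h x)
  refine hom_ext fun ω => ?_
  simp only [LinearMap.comp_apply, LinearMap.sub_apply, LinearMap.id_apply,
    LinearMap.smulRight_apply, invDegree_forest, map_smul, graft_one_left]
  rcases eq_or_ne ω [] with rfl | h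
  · simp [numVertices, ← one_eq, counit_one]
  · have h' : (ω.numVertices : K) ≠ 0 :=
      Nat.cast_ne_zero.mpr fun h' => h (eq_nil_of_numVertices_eq_zero h')
    rw [counit_forest K h, inv_smul_smul₀ h', zero_smul, sub_zero]

theorem one_growth {x : MKW K C} (hx : counit (R := K) x = 0) : growth K 1 x = x := by
  rw [growth_eq, graft_one_invDegree, hx, zero_smul, sub_zero]

/-- The total degree times each coefficient of Δ̂(`invDegree K y`) is a coefficient of Δ̂(y) = 0.
The degree is nonzero unless both forests are empty, and coefficients with empty left forest vanish
by the counit law. -/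
theorem invDegree_mem_primitiveElements {y : MKW K C} (hy : y ∈ primitiveElements K (MKW K C)) :
    invDegree K y ∈ primitiveElements K (MKW K C) := by
  have h₀ := counit_invDegree K y
  have h := reducedComul_graft_one K (invDegree K y)
  rw [graft_one_invDegree, counit_of_primitive hy, zero_smul, sub_zero,
    show reducedComul K y = 0 from hy] at h
  refine ((basis K).tensorProduct (basis K)).ext_elem fun ⟨a, b⟩ => ?_
  rw [map_zero, Finsupp.zero_apply]
  rcases eq_or_ne a [] with rfl | ha
  · rw [repr_nil_left, rTensor_counit_reducedComul K h₀]; simp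
  · have h' := repr_degree K (reducedComul K (invDegree K y)) a b
    rw [← h, map_zero, Finsupp.zero_apply] at h'
    refine (mul_eq_zero.mp h'.symm).resolve_left (Nat.cast_ne_zero.mpr fun h'' => ha ?_)
    exact eq_nil_of_numVertices_eq_zero (by omega)

theorem comul_growth (x : MKW K C) {y : MKW K C} (hy : y ∈ primitiveElements K (MKW K C)) :
    comul (R := K) (growth K x y) =
      growth K x y ⊗ₜ 1 + ((growth K).flip y).lTensor _ (comul (R := K) x) := by
  rw [growth_flip, growth_eq,
    comul_graft_of_primitive K x (invDegree_mem_primitiveElements K hy)]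

theorem isNaturalGrowth_growth : IsNaturalGrowth (growth K (C := C)) := by
  intro x y hy
  rw [reducedComul_apply, comul_growth K x hy, comul_eq K x]
  simp only [map_add, LinearMap.lTensor_tmul, LinearMap.flip_apply,
    one_growth K (counit_of_primitive hy)]
  abel

/-- The counit laws exclude empty factors; the coderivation property compares degrees in `K`, and
characteristic zero brings the equality back to ℕ. -/
theorem numVertices_of_repr_reducedComul_ne_zero {ω a b : OrderedForest C} (hω : ω ≠ [])
    (h : ((basis K).tensorProduct (basis K)).repr (reducedComul K (forest K ω)) (a, b) ≠ 0) :
    a ≠ [] ∧ b ≠ [] ∧ a.numVertices + b.numVertices = ω.numVertices := by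
  have h₀ := counit_forest K hω
  refine ⟨?_, ?_, ?_⟩
  · rintro rfl
    rw [repr_nil_left, rTensor_counit_reducedComul K h₀] at h
    simp at h
  · rintro rfl
    rw [repr_nil_right, lTensor_counit_reducedComul K h₀] at h
    simp at h
  · have h' := repr_degree K (reducedComul K (forest K ω)) a b
    rw [← reducedComul_graft_one, graft_one_left, map_smul, map_smul, Finsupp.smul_apply,
      smul_eq_mul] at h'
    exact_mod_cast (mul_right_cancel₀ h h').symm

variable {K}

/-- The reduced coproduct of a nonempty forest only involves smaller nonempty forests. -/
theorem reducedComul_congr {M : Type*} [AddCommGroup M] [Module K M]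
    {Φ Ψ : MKW K C ⊗[K] MKW K C →ₗ[K] M} {ω : OrderedForest C} (hω : ω ≠ [])
    (h : ∀ a b : OrderedForest C, b ≠ [] → a.numVertices < ω.numVertices →
      b.numVertices < ω.numVertices →
      Φ (forest K a ⊗ₜ forest K b) = Ψ (forest K a ⊗ₜ forest K b)) :
    Φ (reducedComul K (forest K ω)) = Ψ (reducedComul K (forest K ω)) := by
  rw [← ((basis K).tensorProduct (basis K)).linearCombination_repr (reducedComul K (forest K ω)),
    Finsupp.linearCombination_apply, map_finsuppSum, map_finsuppSum]
  refine Finsupp.sum_congr fun ⟨a, b⟩ hab => ?_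
  obtain ⟨ha, hb, hn⟩ :=
    numVertices_of_repr_reducedComul_ne_zero K hω (Finsupp.mem_support_iff.mp hab)
  have ha' : a.numVertices ≠ 0 := fun h => ha (eq_nil_of_numVertices_eq_zero h)
  have hb' : b.numVertices ≠ 0 := fun h => hb (eq_nil_of_numVertices_eq_zero h)
  rw [map_smul, map_smul, Module.Basis.tensorProduct_apply, basis_apply, basis_apply,
    h a b hb (by omega) (by omega)]

/-- The full coproduct adds ω ⊗ 1, which is assumed separately, and 1 ⊗ ω, which is the case of
empty `a`. -/
theorem comul_congr {M : Type*} [AddCommGroup M] [Module K M]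
    {Φ Ψ : MKW K C ⊗[K] MKW K C →ₗ[K] M} {ω : OrderedForest C}
    (h₁ : Φ (forest K ω ⊗ₜ 1) = Ψ (forest K ω ⊗ₜ 1))
    (h : ∀ a b : OrderedForest C, a.numVertices < ω.numVertices →
      Φ (forest K a ⊗ₜ forest K b) = Ψ (forest K a ⊗ₜ forest K b)) :
    Φ (comul (R := K) (forest K ω)) = Ψ (comul (R := K) (forest K ω)) := by
  rcases eq_or_ne ω [] with rfl | hω
  · rw [← one_eq] at h₁ ⊢
    rw [comul_one, h₁]
  · have hω' : ω.numVertices ≠ 0 := fun h => hω (eq_nil_of_numVertices_eq_zero h)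
    rw [comul_eq, map_add, map_add, map_add, map_add, h₁,
      reducedComul_congr hω fun a b _ ha _ => h a b ha, one_eq,
      h [] ω (by simp only [numVertices]; omega)]

/-! #### The recursive projection -/

variable (K C) in
theorem exists_isRecursiveProjection :
    ∃ π : MKW K C →ₗ[K] MKW K C, IsRecursiveProjection (growth K) π := by
  obtain ⟨π, hπ⟩ := exists_fixedPoint K (C := C) (M := MKW K C)
    -- Precomposing with x ↦ x - ε(x) 1 extends the recursion from the augmentation ideal to the
    -- whole space and forces π(1) = 0.
    (fun π => (LinearMap.id - TensorProduct.lift (growth K) ∘ₗ π.lTensor _ ∘ₗ reducedComul K) ∘ₗ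
      (LinearMap.id - (counit (R := K)).smulRight 1)) (by
    intro f g ω h
    simp only [LinearMap.comp_apply, LinearMap.sub_apply, LinearMap.id_apply,
      LinearMap.smulRight_apply]
    rcases eq_or_ne ω [] with rfl | hω
    · simp [← one_eq, counit_one]
    · rw [counit_forest K hω, zero_smul, sub_zero]
      congr 1
      refine reducedComul_congr (Φ := TensorProduct.lift (growth K) ∘ₗ f.lTensor _)
        (Ψ := TensorProduct.lift (growth K) ∘ₗ g.lTensor _) hω fun a b _ _ hb => ?_
      simp [h b hb])
  refine ⟨π, ?_, fun x hx => ?_⟩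
  · rw [← hπ]
    simp [counit_one]
  · conv_lhs => rw [← hπ]
    simp [hx]

theorem _root_.IsRecursiveProjection.unique {π ρ : MKW K C →ₗ[K] MKW K C}
    (hπ : IsRecursiveProjection (growth K) π) (hρ : IsRecursiveProjection (growth K) ρ) :
    π = ρ := by
  refine hom_ext fun ω => ?_
  induction h : ω.numVertices using Nat.strong_induction_on generalizing ω with
  | _ n ih =>
    rcases eq_or_ne ω [] with rfl | hω
    · rw [← one_eq, hπ.1, hρ.1]
    · rw [hπ.2 _ (counit_forest K hω), hρ.2 _ (counit_forest K hω)]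
      congr 1
      refine reducedComul_congr (Φ := TensorProduct.lift (growth K) ∘ₗ π.lTensor _)
        (Ψ := TensorProduct.lift (growth K) ∘ₗ ρ.lTensor _) hω fun a b _ _ hb => ?_
      simp [ih _ (h ▸ hb) b rfl]

/-- Apply Δ̂ to x⁽¹⁾ ⊤ π(x⁽²⁾). By induction π(x⁽²⁾) is primitive, so natural growth gives (id ⊗
π)Δ̂(x) plus a term in the iterated Δ̂. After coassociativity, the recursion for π turns that term
into Δ̂(x) - (id ⊗ π)Δ̂(x). The total is Δ̂(x). -/
theorem _root_.IsRecursiveProjection.apply_mem {π : MKW K C →ₗ[K] MKW K C}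
    (hπ : IsRecursiveProjection (growth K) π) (x : MKW K C) :
    π x ∈ primitiveElements K (MKW K C) := by
  suffices h : reducedComul K ∘ₗ π = 0 from congr($h x)
  refine hom_ext fun ω => ?_
  rw [LinearMap.comp_apply, LinearMap.zero_apply]
  induction h : ω.numVertices using Nat.strong_induction_on generalizing ω with
  | _ n ih =>
    rcases eq_or_ne ω [] with rfl | hω
    · rw [← one_eq, hπ.1, map_zero]
    · have h₁ : reducedComul K (TensorProduct.lift (growth K)
          (π.lTensor _ (reducedComul K (forest K ω)))) =
          π.lTensor _ (reducedComul K (forest K ω)) +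
          (TensorProduct.lift (growth K) ∘ₗ π.lTensor _).lTensor _ (TensorProduct.assoc K _ _ _
            ((reducedComul K).rTensor _ (reducedComul K (forest K ω)))) := by
        refine reducedComul_congr
          (Φ := reducedComul K ∘ₗ TensorProduct.lift (growth K) ∘ₗ π.lTensor _)
          (Ψ := π.lTensor _ + (TensorProduct.lift (growth K) ∘ₗ π.lTensor _).lTensor _ ∘ₗ
            (TensorProduct.assoc K _ _ _).toLinearMap ∘ₗ (reducedComul K).rTensor _)
          hω fun a b _ _ hb => ?_
        simp only [LinearMap.add_apply, LinearMap.coe_comp, LinearEquiv.coe_coe,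
          Function.comp_apply, LinearMap.lTensor_tmul, TensorProduct.lift.tmul,
          LinearMap.rTensor_tmul]
        rw [isNaturalGrowth_growth K _ _ (ih _ (h ▸ hb) b rfl)]
        congr 1
        exact (lTensor_lift_growth_assoc_tmul π _ _).symm
      have h₂ : (TensorProduct.lift (growth K) ∘ₗ π.lTensor _).lTensor _
          ((reducedComul K).lTensor _ (reducedComul K (forest K ω))) =
          reducedComul K (forest K ω) - π.lTensor _ (reducedComul K (forest K ω)) := by
        refine reducedComul_congr
          (Φ := (TensorProduct.lift (growth K) ∘ₗ π.lTensor _).lTensor _ ∘ₗ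
            (reducedComul K).lTensor _)
          (Ψ := LinearMap.id - π.lTensor _) hω fun a b hb _ _ => ?_
        simp [hπ.2 _ (counit_forest K hb), TensorProduct.tmul_sub]
      rw [hπ.2 _ (counit_forest K hω), map_sub, h₁, coassoc_reducedComul, h₂]
      abel

/-- Passing from Δ̂ to Δ adds 1 ⊤ π(x) = π(x) and x ⊤ π(1) = 0, so the recursion becomes a
reconstruction of x. -/
theorem _root_.IsRecursiveProjection.lift_lTensor_comul {π : MKW K C →ₗ[K] MKW K C}
    (hπ : IsRecursiveProjection (growth K) π) {x : MKW K C} (hx : counit (R := K) x = 0) :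
    TensorProduct.lift (growth K) (π.lTensor _ (comul (R := K) x)) = x := by
  rw [comul_eq]
  simp only [map_add, LinearMap.lTensor_tmul, TensorProduct.lift.tmul, hπ.1, map_zero, add_zero,
    one_growth K (counit_of_primitive (hπ.apply_mem x))]
  rw [hπ.2 x hx]
  abel

/-- For a nonempty forest, natural growth turns the recursion into x ⊤ p - x ⊤ π(p) - x⁽¹⁾ ⊤ π(x⁽²⁾
⊤ p). The first two terms cancel, and the last is zero by induction since ε(x⁽²⁾) = 0. -/
theorem _root_.IsRecursiveProjection.apply_growth {π : MKW K C →ₗ[K] MKW K C}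
    (hπ : IsRecursiveProjection (growth K) π) (x : MKW K C) {p : MKW K C}
    (hp : p ∈ primitiveElements K (MKW K C)) :
    π (growth K x p) = counit (R := K) x • p := by
  suffices h : π ∘ₗ (growth K).flip p = (counit (R := K)).smulRight p from congr($h x)
  refine hom_ext fun ω => ?_
  rw [LinearMap.comp_apply, LinearMap.flip_apply, LinearMap.smulRight_apply]
  induction h : ω.numVertices using Nat.strong_induction_on generalizing ω with
  | _ n ih =>
    rcases eq_or_ne ω [] with rfl | hω
    · rw [← one_eq, one_growth K (counit_of_primitive hp), counit_one, one_smul,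
        hπ.apply_primitive hp]
    · have h₁ : TensorProduct.lift (growth K) (π.lTensor _
          (((growth K).flip p).lTensor _ (reducedComul K (forest K ω)))) = 0 := by
        refine reducedComul_congr (Φ := TensorProduct.lift (growth K) ∘ₗ π.lTensor _ ∘ₗ
          ((growth K).flip p).lTensor _) (Ψ := 0) hω fun a b hb₀ _ hb => ?_
        simp only [LinearMap.comp_apply, LinearMap.lTensor_tmul, LinearMap.flip_apply,
          ih _ (h ▸ hb) b rfl, counit_forest K hb₀, zero_smul, TensorProduct.tmul_zero, map_zero,
          LinearMap.zero_apply]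
      rw [hπ.2 _ (counit_growth K _ _), isNaturalGrowth_growth K _ _ hp, map_add, map_add, h₁,
        LinearMap.lTensor_tmul, TensorProduct.lift.tmul, hπ.apply_primitive hp,
        counit_forest K hω, zero_smul, add_zero, sub_self]

end Growth

end MKW

/-! ### Words and last letters in the tensor coalgebra -/

theorem TensorAlgebra.span_range_prod_ι (K : Type u) (V : Type v) [CommRing K] [AddCommGroup V]
    [Module K V] :
    Submodule.span K (Set.range fun l : List V => (l.map (TensorAlgebra.ι K)).prod) = ⊤ := by
  refine eq_top_iff.mpr fun t _ => ?_
  induction t using TensorAlgebra.induction with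
  | algebraMap r =>
    rw [Algebra.algebraMap_eq_smul_one]
    exact Submodule.smul_mem _ _ (Submodule.subset_span ⟨[], rfl⟩)
  | ι x => exact Submodule.subset_span ⟨[x], by simp⟩
  | add a b ha hb => exact Submodule.add_mem _ (ha trivial) (hb trivial)
  | mul a b ha hb =>
    have hab := Submodule.mul_mem_mul (ha trivial) (hb trivial)
    rw [Submodule.span_mul_span] at hab
    refine Submodule.span_mono ?_ hab
    rintro _ ⟨_, ⟨l, rfl⟩, _, ⟨l', rfl⟩, rfl⟩
    exact ⟨l ++ l', by simp⟩

namespace TensorCoalgebra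

open CoalgebraStruct

variable (K : Type u) {V : Type v} [CommRing K] [AddCommGroup V] [Module K V]

/-- Appending a letter to a word. -/
noncomputable def snoc : TensorCoalgebra K V →ₗ[K] V →ₗ[K] TensorCoalgebra K V :=
  (LinearMap.mul K (TensorAlgebra K V)).compl₂ (TensorAlgebra.ι K)

theorem word_append_singleton (l : List V) (p : V) :
    word K (l ++ [p]) = snoc K (word K l) p := by
  change ((l ++ [p]).map (TensorAlgebra.ι K)).prod = (l.map (TensorAlgebra.ι K)).prod * _
  simp

theorem counit_word_nil : counit (R := K) (word K ([] : List V)) = 1 :=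
  map_one TensorAlgebra.algebraMapInv

theorem counit_snoc (t : TensorCoalgebra K V) (p : V) : counit (R := K) (snoc K t p) = 0 := by
  let t' : TensorAlgebra K V := t
  change TensorAlgebra.algebraMapInv (t' * TensorAlgebra.ι K p) = 0
  simp [TensorAlgebra.algebraMapInv]

variable {K} in
theorem hom_ext {M : Type*} [AddCommGroup M] [Module K M] {f g : TensorCoalgebra K V →ₗ[K] M}
    (h : ∀ l, f (word K l) = g (word K l)) : f = g := by
  let f' : TensorAlgebra K V →ₗ[K] M := f
  let g' : TensorAlgebra K V →ₗ[K] M := g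
  exact LinearMap.ext_on_range (f := f') (g := g') (TensorAlgebra.span_range_prod_ι K V) h

/-- The linear map out of the tensor coalgebra that sends `v₁ ⊗ ⋯ ⊗ vₙ` to
`(⋯((x · v₁) · v₂)⋯) · vₙ`, where `·` is the given right action of `V`. -/
noncomputable def foldAction {M : Type*} [AddCommGroup M] [Module K M] (T : M →ₗ[K] V →ₗ[K] M)
    (x : M) : TensorCoalgebra K V →ₗ[K] M :=
  -- Letters act from left to right while endomorphisms compose from right to left, hence the
  -- opposite algebra.
  LinearMap.applyₗ x ∘ₗ (MulOpposite.opLinearEquiv K).symm.toLinearMap ∘ₗ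
    (TensorAlgebra.lift K
      ((MulOpposite.opLinearEquiv K (M := Module.End K M)).toLinearMap ∘ₗ T.flip)).toLinearMap

theorem foldAction_word_nil {M : Type*} [AddCommGroup M] [Module K M] (T : M →ₗ[K] V →ₗ[K] M)
    (x : M) : foldAction K T x (word K []) = x := by
  let φ := TensorAlgebra.lift K
    ((MulOpposite.opLinearEquiv K (M := Module.End K M)).toLinearMap ∘ₗ T.flip)
  change (φ 1).unop x = x
  rw [map_one]
  rfl

theorem foldAction_snoc {M : Type*} [AddCommGroup M] [Module K M] (T : M →ₗ[K] V →ₗ[K] M)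
    (x : M) (t : TensorCoalgebra K V) (p : V) :
    foldAction K T x (snoc K t p) = T (foldAction K T x t) p := by
  let φ := TensorAlgebra.lift K
    ((MulOpposite.opLinearEquiv K (M := Module.End K M)).toLinearMap ∘ₗ T.flip)
  let t' : TensorAlgebra K V := t
  change (φ (t' * TensorAlgebra.ι K p)).unop x = T ((φ t').unop x) p
  rw [map_mul, TensorAlgebra.lift_ι_apply]
  rfl

end TensorCoalgebra

/-! ### The coalgebra isomorphism -/

namespace MKW

open CoalgebraStruct OrderedForest TensorCoalgebra

variable (K : Type u) {C : Type v} [Field K]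

/-- The linear map `p₁ ⊗ ⋯ ⊗ pₙ ↦ p₁ ⊤ ⋯ ⊤ pₙ`. -/
noncomputable def ofWords : TensorCoalgebra K (primitiveElements K (MKW K C)) →ₗ[K] MKW K C :=
  foldAction K ((growth K).compl₂ (primitiveElements K (MKW K C)).subtype) 1

theorem ofWords_nil : ofWords K (word K ([] : List (primitiveElements K (MKW K C)))) = 1 :=
  foldAction_word_nil K _ _

theorem ofWords_snoc (t : TensorCoalgebra K (primitiveElements K (MKW K C)))
    (p : primitiveElements K (MKW K C)) :
    ofWords K (snoc K t p) = growth K (ofWords K t) p :=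
  foldAction_snoc K _ _ _ _

theorem counit_ofWords (t : TensorCoalgebra K (primitiveElements K (MKW K C))) :
    counit (R := K) (ofWords K t) = counit (R := K) t := by
  suffices h : counit (R := K) ∘ₗ ofWords K (C := C) = counit (R := K) from congr($h t)
  refine TensorCoalgebra.hom_ext fun l => ?_
  rw [LinearMap.comp_apply]
  rcases List.eq_nil_or_concat l with rfl | ⟨l, p, rfl⟩
  · rw [ofWords_nil, counit_one, counit_word_nil]
  · rw [List.concat_eq_append, word_append_singleton, ofWords_snoc, counit_growth, counit_snoc]

variable [CharZero K]

/-- `ofWords` starts its fold at 1 and `iteratedGrowth` at the first letter; these agree because 1 ⊤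
p = p for primitive p. -/
theorem iteratedGrowth_eq_ofWords (l : List (primitiveElements K (MKW K C))) :
    iteratedGrowth (growth K) (l.map (primitiveElements K (MKW K C)).subtype) =
      ofWords K (word K l) := by
  have h : ofWords K (word K l) = (l.map (primitiveElements K (MKW K C)).subtype).foldl
      (fun z y => growth K z y) 1 := by
    induction l using List.reverseRecOn with
    | nil => exact ofWords_nil K
    | append_singleton l p ih =>
      rw [word_append_singleton, ofWords_snoc, ih, List.map_append, List.foldl_append]
      rfl
  rw [h]
  cases l with
  | nil => rfl
  | cons p l =>
    rw [List.map_cons, List.foldl_cons, Submodule.subtype_apply,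
      one_growth K (counit_of_primitive p.2)]
    rfl

theorem comul_ofWords (l : List (primitiveElements K (MKW K C))) :
    comul (R := K) (ofWords K (word K l)) = ∑ k ∈ Finset.range (l.length + 1),
      ofWords K (word K (l.take k)) ⊗ₜ[K] ofWords K (word K (l.drop k)) := by
  induction l using List.reverseRecOn with
  | nil => simp [ofWords_nil, comul_one]
  | append_singleton l p ih =>
    rw [word_append_singleton, ofWords_snoc, comul_growth K _ p.2, ih, List.length_append,
      List.length_singleton, Finset.sum_range_succ _ (l.length + 1), add_comm, map_sum]
    -- Cutting before the appended letter gives the terms x' ⊗ (x'' ⊤ p); the last position, after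
    -- it, gives (x ⊤ p) ⊗ 1.
    refine congrArg₂ _ (Finset.sum_congr rfl fun k hk => ?_) ?_
    · have hk' : k ≤ l.length := Nat.lt_succ_iff.mp (Finset.mem_range.mp hk)
      rw [List.take_append_of_le_length hk', List.drop_append_of_le_length hk',
        word_append_singleton, ofWords_snoc]
      rfl
    · rw [List.take_of_length_le (by simp), List.drop_of_length_le (by simp), ofWords_nil,
        word_append_singleton, ofWords_snoc]

theorem map_ofWords_comul (t : TensorCoalgebra K (primitiveElements K (MKW K C))) :
    TensorProduct.map (ofWords K) (ofWords K) (comul (R := K) t) =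
      comul (R := K) (ofWords K t) := by
  suffices h : TensorProduct.map (ofWords K) (ofWords K) ∘ₗ comul (R := K) =
    comul (R := K) ∘ₗ ofWords K (C := C) from congr($h t)
  refine TensorCoalgebra.hom_ext fun l => ?_
  rw [LinearMap.comp_apply, LinearMap.comp_apply, comul_word, comul_ofWords, map_sum]
  rfl

variable {K}

/-- The inverse of `ofWords`: it splits off the last letter by means of the recursive projection. -/
theorem exists_toWords (π : MKW K C →ₗ[K] primitiveElements K (MKW K C)) (hπ : π 1 = 0) :
    ∃ G : MKW K C →ₗ[K] TensorCoalgebra K (primitiveElements K (MKW K C)),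
      ∀ x, G x = counit (R := K) x • word K [] +
        TensorProduct.lift (snoc K) (TensorProduct.map G π (comul (R := K) x)) := by
  obtain ⟨G, hG⟩ := exists_fixedPoint K (C := C)
    (fun G : MKW K C →ₗ[K] TensorCoalgebra K (primitiveElements K (MKW K C)) =>
      (counit (R := K)).smulRight (word K []) +
        TensorProduct.lift (snoc K) ∘ₗ TensorProduct.map G π ∘ₗ comul (R := K)) (by
    intro f g ω h
    simp only [LinearMap.add_apply, LinearMap.comp_apply]
    congr 1
    -- The only term whose left factor is not smaller is ω ⊗ 1, and π(1) = 0 removes it.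
    refine comul_congr (Φ := TensorProduct.lift (snoc K) ∘ₗ TensorProduct.map f π)
      (Ψ := TensorProduct.lift (snoc K) ∘ₗ TensorProduct.map g π) ?_ fun a b ha => ?_
    · simp [hπ]
    · simp [h a ha])
  exact ⟨G, fun x => (congr($hG x)).symm⟩

theorem exists_coalgEquiv :
    ∃ e : TensorCoalgebra K (primitiveElements K (MKW K C)) ≃ₗc[K] MKW K C,
      ∀ t, e t = ofWords K t := by
  obtain ⟨π₀, hπ₀⟩ := exists_isRecursiveProjection K C
  set π : MKW K C →ₗ[K] primitiveElements K (MKW K C) := π₀.codRestrict _ hπ₀.apply_mem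
  have hπ₁ : π 1 = 0 := Subtype.ext hπ₀.1
  have hπ₂ : ∀ x (p : primitiveElements K (MKW K C)),
      π (growth K x p) = counit (R := K) x • p := fun x p => Subtype.ext (hπ₀.apply_growth x p.2)
  obtain ⟨G, hG⟩ := exists_toWords π hπ₁
  have hG₁ : G 1 = word K [] := by
    rw [hG, comul_one, counit_one, TensorProduct.map_tmul, hπ₁, TensorProduct.tmul_zero, map_zero,
      add_zero, one_smul]
  -- Since π(x ⊤ p) = ε(x) p, the counit contracts the right factor and only the letter `p` is split
  -- off.
  have hG₂ : ∀ (X : MKW K C ⊗[K] MKW K C) (p : primitiveElements K (MKW K C)),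
      TensorProduct.lift (snoc K)
        (TensorProduct.map G π (((growth K).flip (p : MKW K C)).lTensor _ X)) =
      snoc K (G (TensorProduct.rid K _ ((counit (R := K)).lTensor _ X))) p := fun X p => by
    induction X with
    | zero => simp
    | add x x' h h' => simp only [map_add, LinearMap.add_apply, h, h']
    | tmul z z' => simp [hπ₂]
  have hl : G ∘ₗ ofWords K = LinearMap.id := by
    refine TensorCoalgebra.hom_ext fun l => ?_
    rw [LinearMap.comp_apply, LinearMap.id_apply]
    induction l using List.reverseRecOn with
    | nil => rw [ofWords_nil, hG₁]
    | append_singleton l p ih =>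
      rw [word_append_singleton, ofWords_snoc, hG, counit_growth, zero_smul, zero_add,
        comul_growth K _ p.2, map_add, map_add, hG₂, lTensor_counit_comul, ih,
        TensorProduct.map_tmul, hπ₁, TensorProduct.tmul_zero, map_zero, zero_add]
  have hr : ofWords K ∘ₗ G = LinearMap.id := by
    refine hom_ext fun ω => ?_
    rw [LinearMap.comp_apply, LinearMap.id_apply]
    induction h : ω.numVertices using Nat.strong_induction_on generalizing ω with
    | _ n ih =>
      rcases eq_or_ne ω [] with rfl | hω
      · rw [← one_eq, hG₁, ofWords_nil]
      · have h₀ := counit_forest K hω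
        rw [hG, h₀, zero_smul, zero_add]
        -- By induction `ofWords K` undoes `G` on the smaller left factors, so what remains is the
        -- reconstruction x = x' ⊤ π(x'').
        refine Eq.trans ?_ (hπ₀.lift_lTensor_comul h₀)
        refine comul_congr (Φ := ofWords K ∘ₗ TensorProduct.lift (snoc K) ∘ₗ TensorProduct.map G π)
          (Ψ := TensorProduct.lift (growth K) ∘ₗ π₀.lTensor _) ?_ fun a b ha => ?_
        · simp [hπ₁, hπ₀.1]
        · simp only [LinearMap.comp_apply, TensorProduct.map_tmul, TensorProduct.lift.tmul,
            LinearMap.lTensor_tmul, ofWords_snoc, ih _ (h ▸ ha) a rfl]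
          rfl
  exact ⟨{ ofWords K with
    counit_comp := LinearMap.ext (counit_ofWords K)
    map_comp_comul := LinearMap.ext (map_ofWords_comul K)
    invFun := G
    left_inv := fun t => congr($hl t)
    right_inv := fun x => congr($hr x) }, fun t => rfl⟩

end MKW

theorem mainTheorem2 (K : Type*) [Field K] [CharZero K] (C : Type*) :
    IsNaturalGrowth (MKW.growth K (C := C)) ∧
    (∃ e : TensorCoalgebra K (primitiveElements K (MKW K C)) ≃ₗc[K] MKW K C,
      ∀ l : List (primitiveElements K (MKW K C)),
        e (TensorCoalgebra.word K l) =
          iteratedGrowth (MKW.growth K) (l.map (primitiveElements K (MKW K C)).subtype)) ∧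
    (∃! π : MKW K C →ₗ[K] MKW K C, IsRecursiveProjection (MKW.growth K) π) ∧
    (∀ π : MKW K C →ₗ[K] MKW K C, IsRecursiveProjection (MKW.growth K) π →
      LinearMap.IsProj (primitiveElements K (MKW K C)) π) := by
  refine ⟨MKW.isNaturalGrowth_growth K, ?_, ?_, fun π hπ =>
    ⟨hπ.apply_mem, fun _ hp => hπ.apply_primitive hp⟩⟩
  · obtain ⟨e, he⟩ := MKW.exists_coalgEquiv (K := K) (C := C)
    exact ⟨e, fun l => by rw [he, MKW.iteratedGrowth_eq_ofWords]⟩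
  · obtain ⟨π, hπ⟩ := MKW.exists_isRecursiveProjection K C
    exact ⟨π, hπ, fun ρ hρ => hρ.unique hπ⟩
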